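/- **Setting.** Let $d\ge 1$, $\Theta=[\theta_{inf},\theta_{sup}]^p$, and let $\{K_\theta,\theta\in\Theta\}$ be a family of stationary covariance functions on $\mathbb R^d$ with $K_\theta(0)=1$ for all $\theta\in\Theta$, such that: (i) $K_\theta(t)$ is three times differentiable in $\theta$ and, for all $0\le q\le 3$ and all $i_1,\dots,i_q$, there is $C_{i_1,\dots,i_q}<\infty$ with $\left|\frac{\partial}{\partial\theta_{i_1}}\cdots\frac{\partial}{\partial\theta_{i_q}}K_\theta(t)\right|\le \frac{C_{i_1,\dots,i_q}}{1+|t|^{d+1}}$ for all $\theta\in\Theta$, $t\in\mathbb R^d$ ($|\cdot|$ the Euclidean norm); (ii) with $\hat K_\theta(f)=(2\pi)^{-d}\int_{\mathbb R^d}K_\theta(t)e^{-\mathrm i f\cdot t}\,dt$, one has $K_\theta(t)=\int_{\mathbb R^d}\hat K_\theta(f)e^{\mathrm i f\cdot t}\,df$ (absolutely convergent); (iii) $(f,\theta)\mapsto\hat K_\theta(f)$ is continuous and positive on $\mathbb R^d\times\Theta$. Let $\theta_0$ satisfy $\theta_{inf}<(\theta_0)_i<\theta_{sup}$ for all $i$,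 and let $Y$ be a centered Gaussian process on $\mathbb R^d$ with covariance function $K_{\theta_0}$. Let $(v_i)_{i\ge1}$ be a sequence of points with $\{v_i:1\le i\le N^d\}=\{1,\dots,N\}^d$ for all $N\ge1$, let $\epsilon\in[0,\frac12)$, and let $X_1,X_2,\dots$ be i.i.d., independent of $Y$ (defined on the other factor of a product probability space), with a symmetric law $\mathcal L_X$ whose (topological) support $S_X$ is contained in $[-1,1]^d$ and which has a probability density that is positive on $S_X$. Put $y_i=Y(v_i+\epsilon X_i)$ and, for $1\le i\le n$, let $\hat y_{i,\theta}(y_{-i})=\mathbb E_{\theta|X}(y_i\mid y_1,\dots,y_{i-1},y_{i+1},\dots,y_n)$ be the Kriging leave-one-out prediction, i.e. the conditional expectation computed, with $X$ given, as if the covariance function of $Y$ were $K_\theta$. Let $$D_p(\theta,\theta_0)=\mathbb E\Big[\frac1n\sum_{i=1}^n\{y_i-\hat y_{i,\theta}(y_{-i})\}^2\Big]-\mathbb E\Big[\frac1n\sum_{i=1}^n\{y_i-\hat y_{i,\theta_0}(y_{-i})\}^2\Big],$$ which depends on $n$. **Proposition.** 1. Let $\epsilon=0$ and $I(\theta)=\sum_{v\in\mathbb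 Z^d}\{K_\theta(v)-K_{\theta_0}(v)\}^2$. Then $I(\theta)<\infty$ for all $\theta\in\Theta$, and there are constants $0<A<B<\infty$ such that for all $\theta\in\Theta$ $$A\,I(\theta)\le\liminf_{n\to\infty}D_p(\theta,\theta_0),\qquad \limsup_{n\to\infty}D_p(\theta,\theta_0)\le B\,I(\theta).$$ 2. Let $\epsilon\ne0$, $C_{S_X}=\{t_1-t_2:t_1,t_2\in S_X\}$, $D_\epsilon=\bigcup_{v\in\mathbb Z^d\setminus\{0\}}(v+\epsilon C_{S_X})$ and $I(\theta)=\int_{D_\epsilon}\{K_\theta(t)-K_{\theta_0}(t)\}^2\,dt$. Then $I(\theta)<\infty$ for all $\theta\in\Theta$, and for every $\delta>0$ there are constants $0<A<B<\infty$ such that, for all $\theta\in\Theta$ with $I(\theta)=0$ or $I(\theta)\ge\delta$, $$A\,I(\theta)\le\liminf_{n\to\infty}D_p(\theta,\theta_0),\qquad \limsup_{n\to\infty}D_p(\theta,\theta_0)\le B\,I(\theta).$$ In particular, for every fixed $\theta\in\Theta$ there are such constants $A,B$ (depending on $\theta$). -/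

import Mathlib

open MeasureTheory ProbabilityTheory Filter Topology
open scoped ENNReal

namespace KrigingLOO

/-- The parameter set `[θinf, θsup]^p`. -/
def paramSet (p : ℕ) (θinf θsup : ℝ) : Set (Fin p → ℝ) :=
  Set.Icc (fun _ => θinf) (fun _ => θsup)

/-- The covariance matrix `(k (s i - s j))` of the values at the points `s` of a process with
stationary covariance function `k`. -/
def covMatrix {d n : ℕ} (k : EuclideanSpace ℝ (Fin d) → ℝ) (s : Fin n → EuclideanSpace ℝ (Fin d)) :
    Matrix (Fin n) (Fin n) ℝ :=
  Matrix.of fun i j => k (s i - s j)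

/-- `k` is a stationary covariance function: all its finite matrices are symmetric and
positive semidefinite. -/
def IsStationaryCovariance {d : ℕ} (k : EuclideanSpace ℝ (Fin d) → ℝ) : Prop :=
  ∀ (n : ℕ) (s : Fin n → EuclideanSpace ℝ (Fin d)), (covMatrix k s).PosSemidef

/-- The iterated partial derivative `∂/∂θ_{i₁} ⋯ ∂/∂θ_{i_q} K_θ(t)` for the list `[i₁, …, i_q]`
(one-sided on the boundary of the parameter cube). -/
noncomputable def partialTheta {d p : ℕ} (θinf θsup : ℝ)
    (K : (Fin p → ℝ) → EuclideanSpace ℝ (Fin d) → ℝ) :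
    List (Fin p) → (Fin p → ℝ) → EuclideanSpace ℝ (Fin d) → ℝ
  | [] => K
  | i :: l => fun θ t =>
      derivWithin (fun u : ℝ => partialTheta θinf θsup K l (Function.update θ i u) t)
        (Set.Icc θinf θsup) (θ i)

/-- The Fourier transform `ĥ(f) = (2π)^{-d} ∫ h(t) e^{-i f·t} dt`. -/
noncomputable def fourierHat {d : ℕ} (h : EuclideanSpace ℝ (Fin d) → ℝ)
    (f : EuclideanSpace ℝ (Fin d)) : ℂ :=
  (1 / (2 * (Real.pi : ℂ)) ^ d) *
    ∫ t : EuclideanSpace ℝ (Fin d), (h t : ℂ) * Complex.exp (-Complex.I * ((inner ℝ f t : ℝ) : ℂ))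

/-- The regularity condition on the parametric family `K_θ`, `θ ∈ [θinf, θsup]^p`. -/
structure RegularModel {d p : ℕ} (θinf θsup : ℝ)
    (K : (Fin p → ℝ) → EuclideanSpace ℝ (Fin d) → ℝ) : Prop where
  /-- each `K_θ` is a stationary covariance function -/
  stationary : ∀ θ ∈ paramSet p θinf θsup, IsStationaryCovariance (K θ)
  /-- `K_θ` is three times differentiable in `θ` -/
  differentiable : ∀ l : List (Fin p), l.length < 3 → ∀ (i : Fin p),
    ∀ θ ∈ paramSet p θinf θsup, ∀ t : EuclideanSpace ℝ (Fin d),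
      DifferentiableWithinAt ℝ
        (fun u : ℝ => partialTheta θinf θsup K l (Function.update θ i u) t)
        (Set.Icc θinf θsup) (θ i)
  /-- the partial derivatives of order `0, …, 3` are bounded by `C / (1 + |t|^{d+1})` -/
  bound : ∀ l : List (Fin p), l.length ≤ 3 → ∃ C : ℝ,
    ∀ θ ∈ paramSet p θinf θsup, ∀ t : EuclideanSpace ℝ (Fin d),
      |partialTheta θinf θsup K l θ t| ≤ C / (1 + ‖t‖ ^ (d + 1))
  /-- Fourier inversion holds for `K_θ`, with an absolutely convergent integral -/
  integrable_hat : ∀ θ ∈ paramSet p θinf θsup, Integrable (fourierHat (K θ))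
  inversion : ∀ θ ∈ paramSet p θinf θsup, ∀ t : EuclideanSpace ℝ (Fin d),
    (K θ t : ℂ) = ∫ f : EuclideanSpace ℝ (Fin d),
      fourierHat (K θ) f * Complex.exp (Complex.I * ((inner ℝ f t : ℝ) : ℂ))
  /-- `(f, θ) ↦ K̂_θ(f)` is continuous -/
  continuous_hat : ContinuousOn
    (fun q : EuclideanSpace ℝ (Fin d) × (Fin p → ℝ) => fourierHat (K q.2) q.1)
    (Set.univ ×ˢ paramSet p θinf θsup)
  /-- `K̂_θ(f)` is real and positive -/
  pos_hat : ∀ θ ∈ paramSet p θinf θsup, ∀ f : EuclideanSpace ℝ (Fin d),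
    (fourierHat (K θ) f).im = 0 ∧ 0 < (fourierHat (K θ) f).re

/-- A point of `ℤ^d` as a point of `ℝ^d`. -/
noncomputable def latticePoint {d : ℕ} (u : Fin d → ℤ) : EuclideanSpace ℝ (Fin d) :=
  WithLp.toLp 2 fun k => (u k : ℝ)

/-- The first `N^d` points of the sequence fill the cube `{1, …, N}^d`, for every `N ≥ 1`
(indices start at `0`). -/
def IsGridEnumeration {d : ℕ} (v : ℕ → Fin d → ℤ) : Prop :=
  ∀ N : ℕ, 1 ≤ N →
    v '' {i | i < N ^ d} = {u : Fin d → ℤ | ∀ k, 1 ≤ u k ∧ u k ≤ (N : ℤ)}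

/-- A symmetric law whose (topological) support is contained in `[-1,1]^d`, with a probability
density function that is positive on the support. -/
structure IsPerturbationLaw {d : ℕ} (μ : Measure (EuclideanSpace ℝ (Fin d))) : Prop where
  probability : IsProbabilityMeasure μ
  symmetric : μ.map (fun x => -x) = μ
  support_subset : ∀ x ∈ μ.support, ∀ k, -1 ≤ x k ∧ x k ≤ 1
  density : ∃ f : EuclideanSpace ℝ (Fin d) → ℝ≥0∞, Measurable f ∧
    μ = volume.withDensity f ∧ ∀ x ∈ μ.support, 0 < f x

/-- The observation point `v_i + ε x_i`. -/
noncomputable def obsPoint {d : ℕ} (v : ℕ → Fin d → ℤ) (ε : ℝ)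
    (x : ℕ → EuclideanSpace ℝ (Fin d)) (i : ℕ) : EuclideanSpace ℝ (Fin d) :=
  latticePoint (v i) + ε • x i

/-- `Y` is a centered Gaussian process on `ℝ^d` with stationary covariance function `k`. -/
structure IsCenteredGaussianField {d : ℕ} {Ω : Type*} [MeasurableSpace Ω]
    (k : EuclideanSpace ℝ (Fin d) → ℝ) (Y : EuclideanSpace ℝ (Fin d) → Ω → ℝ)
    (P : Measure Ω) : Prop where
  gaussian : IsGaussianProcess Y P
  centered : ∀ t, ∫ ω, Y t ω ∂P = 0
  covariance : ∀ s t, cov[Y s, Y t; P] = k (s - t)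

/-- The Kriging leave-one-out prediction of `y_i` at fixed observation points `s`, as a function
of the data vector: the conditional expectation of the `i`-th coordinate given all the other
coordinates, under the centered Gaussian law with covariance function `k`.  (When the covariance
matrix is invertible, two versions of it agree Lebesgue almost everywhere.) -/
noncomputable def krigingPred {d n : ℕ} (k : EuclideanSpace ℝ (Fin d) → ℝ)
    (s : Fin n → EuclideanSpace ℝ (Fin d)) (i : Fin n) : EuclideanSpace ℝ (Fin n) → ℝ :=
  condExp
    (MeasurableSpace.comap (fun (y : EuclideanSpace ℝ (Fin n)) (j : {j : Fin n // j ≠ i}) => y j)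
      MeasurableSpace.pi)
    (multivariateGaussian 0 (covMatrix k s)) (fun y => y i)

/-- `E [ (1/n) ∑ i, (y_i - ŷ_i(y_{-i}))² ]`, where `y_i = Y (v_i + ε X_i)` and the prediction uses
the covariance function `k`.  `X` and `Y` live on the two factors of a product space, so the
expectation is the expectation over `X` of the expectation over `Y` with `X` fixed. -/
noncomputable def looMSE {d : ℕ} {ΩX ΩY : Type*} [MeasurableSpace ΩX] [MeasurableSpace ΩY]
    (k : EuclideanSpace ℝ (Fin d) → ℝ) (v : ℕ → Fin d → ℤ) (ε : ℝ)
    (X : ℕ → ΩX → EuclideanSpace ℝ (Fin d)) (PX : Measure ΩX)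
    (Y : EuclideanSpace ℝ (Fin d) → ΩY → ℝ) (PY : Measure ΩY) (n : ℕ) : ℝ≥0∞ :=
  ∫⁻ ωX, ∫⁻ ωY,
    (let s : Fin n → EuclideanSpace ℝ (Fin d) := fun i => obsPoint v ε (fun j => X j ωX) i
     let y : EuclideanSpace ℝ (Fin n) := WithLp.toLp 2 fun i => Y (s i) ωY
     ENNReal.ofReal ((1 / (n : ℝ)) * ∑ i : Fin n, (y i - krigingPred k s i y) ^ 2)) ∂PY ∂PX

/-- `D_p(θ, θ₀)` at sample size `n`, for `k = K_θ` and `k₀ = K_θ₀`. -/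
noncomputable def looExcess {d : ℕ} {ΩX ΩY : Type*} [MeasurableSpace ΩX] [MeasurableSpace ΩY]
    (k k₀ : EuclideanSpace ℝ (Fin d) → ℝ) (v : ℕ → Fin d → ℤ) (ε : ℝ)
    (X : ℕ → ΩX → EuclideanSpace ℝ (Fin d)) (PX : Measure ΩX)
    (Y : EuclideanSpace ℝ (Fin d) → ΩY → ℝ) (PY : Measure ΩY) (n : ℕ) : EReal :=
  (looMSE k v ε X PX Y PY n : EReal) - (looMSE k₀ v ε X PX Y PY n : EReal)

/-- `D_ε = ⋃_{v ∈ ℤ^d, v ≠ 0} (v + ε C_S)` with `C_S = {t₁ - t₂ : t₁, t₂ ∈ S}`. -/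
def diffDomain {d : ℕ} (ε : ℝ) (S : Set (EuclideanSpace ℝ (Fin d))) :
    Set (EuclideanSpace ℝ (Fin d)) :=
  {u | ∃ w : Fin d → ℤ, w ≠ 0 ∧ ∃ t₁ ∈ S, ∃ t₂ ∈ S, u = latticePoint w + ε • (t₁ - t₂)}

end KrigingLOO

/-! The leave-one-out residuals are linear in the data. If `R` is the covariance matrix used for
prediction, the residual vector is `A y` with `A = diag(R⁻¹)⁻¹ R⁻¹`. When the data have covariance
`R₀`, the sum of the residual variances exceeds its value at `R₀` by exactly the sum, over the rows
`r` of `A - A₀`, of `r ⬝ᵥ R₀ r` (`looForm_sub`). If the spectra of `R` and `R₀` lie in a fixed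
interval `[l, u]` with `l > 0`, this is comparable with `‖A - A₀‖²`, and, since the diagonals are 1,
with `‖R - R₀‖²` (Frobenius norms), with constants that do not depend on `n` (`looForm_sub_le`,
`le_looForm_sub`).

The uniform spectral bounds (`exists_spectralBounds`) come from the separation of the observation
points, which holds because `ε < 1/2`. The upper bound is a Schur test based on the decay of `K θ`.
The lower bound uses that the spectral density is bounded below on a large ball times the compact
parameter cube, while the quadratic form of a wide enough cutoff is coercive on separated points.

Averaging `‖R - R₀‖² / n` over `X` gives a double sum over grid points of energies depending only on
`v i - v j`. It is at most the sum `J(θ)` of these energies over nonzero lattice vectors, and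
eventually at least `2⁻ᵈ` times any finite part of it (`exists_liminf_limsup_bounds`).

For `ε = 0`, `J = I`. For `ε ≠ 0`, `J` integrates the same squared difference against the laws of `w
+ ε (X₁ - X₂)`, whose densities need not be bounded above or away from zero, so `I` and `J` are not
compared linearly. They have the same zeros (`eq_zero_on_diffDomain`, `tsum_pairEnergy_eq_zero`) and
are continuous on the compact cube; hence `J` is bounded below on `{I ≥ δ}`, which yields the
constants. -/

namespace KrigingLOO

/-! ### Frobenius norms and symmetric matrices with two-sided spectral bounds -/

section MatrixBounds

open Matrix

variable {ι : Type*} [Fintype ι]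

/-- The squared Frobenius norm. -/
def frobSq (M : Matrix ι ι ℝ) : ℝ := ∑ i, ∑ j, M i j ^ 2

/-- `M` has operator norm at most `√b` for the Euclidean norm. -/
def OpSqLE (b : ℝ) (M : Matrix ι ι ℝ) : Prop :=
  ∀ z : ι → ℝ, (M *ᵥ z) ⬝ᵥ (M *ᵥ z) ≤ b * (z ⬝ᵥ z)

lemma frobSq_nonneg (M : Matrix ι ι ℝ) : 0 ≤ frobSq M :=
  Finset.sum_nonneg fun _ _ => Finset.sum_nonneg fun _ _ => sq_nonneg _

lemma frobSq_transpose (M : Matrix ι ι ℝ) : frobSq Mᵀ = frobSq M := by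
  unfold frobSq
  rw [Finset.sum_comm]
  rfl

lemma frobSq_sub_comm (M N : Matrix ι ι ℝ) : frobSq (M - N) = frobSq (N - M) := by
  unfold frobSq
  refine Finset.sum_congr rfl fun i _ => Finset.sum_congr rfl fun j _ => ?_
  simp only [Matrix.sub_apply]
  ring

lemma frobSq_add_le (M N : Matrix ι ι ℝ) : frobSq (M + N) ≤ 2 * (frobSq M + frobSq N) := by
  unfold frobSq
  rw [← Finset.sum_add_distrib, Finset.mul_sum]
  refine Finset.sum_le_sum fun i _ => ?_
  rw [← Finset.sum_add_distrib, Finset.mul_sum]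
  refine Finset.sum_le_sum fun j _ => ?_
  simp only [Matrix.add_apply]
  nlinarith [sq_nonneg (M i j - N i j)]

lemma frobSq_diagonal [DecidableEq ι] (a : ι → ℝ) : frobSq (diagonal a) = ∑ i, a i ^ 2 := by
  unfold frobSq
  refine Finset.sum_congr rfl fun i _ => ?_
  rw [Finset.sum_eq_single i]
  · simp
  · intro j _ hj; simp [diagonal_apply_ne _ hj.symm]
  · simp

lemma sum_diag_sq_le_frobSq (M : Matrix ι ι ℝ) : ∑ i, M i i ^ 2 ≤ frobSq M :=
  Finset.sum_le_sum fun i _ =>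
    Finset.single_le_sum (f := fun j => M i j ^ 2) (fun _ _ => sq_nonneg _) (Finset.mem_univ i)

lemma dotProduct_self_nonneg' (z : ι → ℝ) : 0 ≤ z ⬝ᵥ z := by
  simpa [dotProduct, sq] using Finset.sum_nonneg fun i (_ : i ∈ Finset.univ) => sq_nonneg (z i)

lemma dotProduct_sq_le (x y : ι → ℝ) : (x ⬝ᵥ y) ^ 2 ≤ (x ⬝ᵥ x) * (y ⬝ᵥ y) := by
  simpa [dotProduct, sq] using Finset.sum_mul_sq_le_sq_mul_sq Finset.univ x y

/-- The columns of `M * N` are the images under `M` of the columns of `N`; transposing makes the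
outer sum run over columns. -/
lemma frobSq_mul_le {b : ℝ} {M : Matrix ι ι ℝ} (hM : OpSqLE b M) (N : Matrix ι ι ℝ) :
    frobSq (M * N) ≤ b * frobSq N := by
  rw [← frobSq_transpose, ← frobSq_transpose N]
  unfold frobSq
  rw [Finset.mul_sum]
  refine Finset.sum_le_sum fun j _ => ?_
  have := hM (fun i => N i j)
  simpa [dotProduct, Matrix.mulVec, Matrix.mul_apply, sq] using this

lemma frobSq_mul_le' {b : ℝ} {M : Matrix ι ι ℝ} (hM : OpSqLE b M) (hs : Mᵀ = M)
    (N : Matrix ι ι ℝ) : frobSq (N * M) ≤ b * frobSq N := by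
  rw [← frobSq_transpose, transpose_mul, hs, ← frobSq_transpose N]
  exact frobSq_mul_le hM _

lemma OpSqLE.mono {b b' : ℝ} (h : b ≤ b') {M : Matrix ι ι ℝ} (hM : OpSqLE b M) : OpSqLE b' M :=
  fun z => (hM z).trans (mul_le_mul_of_nonneg_right h (dotProduct_self_nonneg' z))

lemma OpSqLE.diagonal [DecidableEq ι] {b : ℝ} {a : ι → ℝ} (h : ∀ i, a i ^ 2 ≤ b) :
    OpSqLE b (Matrix.diagonal a) := by
  intro z
  simp only [dotProduct, mulVec_diagonal, Finset.mul_sum]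
  refine Finset.sum_le_sum fun i _ => ?_
  nlinarith [mul_le_mul_of_nonneg_right (h i) (mul_self_nonneg (z i))]

/-- Two-sided spectral bounds for a symmetric matrix, through its quadratic form. -/
structure SpectralBounds (l u : ℝ) (R : Matrix ι ι ℝ) : Prop where
  symm : Rᵀ = R
  lower : ∀ z : ι → ℝ, l * (z ⬝ᵥ z) ≤ z ⬝ᵥ (R *ᵥ z)
  upper : ∀ z : ι → ℝ, z ⬝ᵥ (R *ᵥ z) ≤ u * (z ⬝ᵥ z)

namespace SpectralBounds

variable {l u : ℝ} {R : Matrix ι ι ℝ}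

lemma form_comm (h : SpectralBounds l u R) (x y : ι → ℝ) : x ⬝ᵥ (R *ᵥ y) = y ⬝ᵥ (R *ᵥ x) := by
  rw [dotProduct_mulVec, ← mulVec_transpose, h.symm, dotProduct_comm]

/-- Cauchy–Schwarz for the positive form of `R`, applied to `z` and `y = R z`, gives `|y|⁴ ≤ (z ⬝ᵥ R
z) (y ⬝ᵥ R y) ≤ u² |z|² |y|²`. It is obtained from the discriminant of the form along `t z + y`, so
no diagonalization is needed. -/
lemma opSqLE (h : SpectralBounds l u R) (hl : 0 < l) (hu : 0 < u) : OpSqLE (u ^ 2) R := by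
  intro z
  set y := R *ᵥ z with hy
  have hyy := dotProduct_self_nonneg' y
  have hzz := dotProduct_self_nonneg' z
  have key : (y ⬝ᵥ y) ^ 2 ≤ (z ⬝ᵥ (R *ᵥ z)) * (y ⬝ᵥ (R *ᵥ y)) := by
    have hq : ∀ t : ℝ, 0 ≤ (z ⬝ᵥ (R *ᵥ z)) * (t * t) + (2 * (y ⬝ᵥ y)) * t
        + y ⬝ᵥ (R *ᵥ y) := by
      intro t
      have h1 := h.lower (t • z + y)
      have h2 : 0 ≤ l * ((t • z + y) ⬝ᵥ (t • z + y)) :=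
        mul_nonneg hl.le (dotProduct_self_nonneg' _)
      have h3 : (t • z + y) ⬝ᵥ (R *ᵥ (t • z + y)) =
          (z ⬝ᵥ (R *ᵥ z)) * (t * t) + (2 * (y ⬝ᵥ y)) * t + y ⬝ᵥ (R *ᵥ y) := by
        have := h.form_comm z y
        simp only [mulVec_add, mulVec_smul, dotProduct_add, add_dotProduct, smul_dotProduct,
          dotProduct_smul, smul_eq_mul]
        rw [this, ← hy]
        ring
      linarith
    have := discrim_le_zero hq
    unfold discrim at this
    nlinarith
  have h1 := h.upper z
  have h2 := h.upper y
  have h3 : (z ⬝ᵥ (R *ᵥ z)) * (y ⬝ᵥ (R *ᵥ y)) ≤ (u * (z ⬝ᵥ z)) * (u * (y ⬝ᵥ y)) := by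
    refine mul_le_mul h1 h2 ?_ (by positivity)
    exact (mul_nonneg hl.le hyy).trans (h.lower y)
  rcases hyy.eq_or_lt with h0 | h0
  · rw [← h0]; positivity
  · have : (y ⬝ᵥ y) * (y ⬝ᵥ y) ≤ (u ^ 2 * (z ⬝ᵥ z)) * (y ⬝ᵥ y) := by nlinarith
    exact le_of_mul_le_mul_right this h0

lemma lower_sq (h : SpectralBounds l u R) (hl : 0 < l) (z : ι → ℝ) :
    l ^ 2 * (z ⬝ᵥ z) ≤ (R *ᵥ z) ⬝ᵥ (R *ᵥ z) := by
  have h1 := h.lower z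
  have h2 := dotProduct_sq_le z (R *ᵥ z)
  have hzz := dotProduct_self_nonneg' z
  rcases hzz.eq_or_lt with h0 | h0
  · rw [← h0, mul_zero]; exact dotProduct_self_nonneg' _
  · have h3 : (l * (z ⬝ᵥ z)) ^ 2 ≤ (z ⬝ᵥ (R *ᵥ z)) ^ 2 :=
      pow_le_pow_left₀ (by positivity) h1 2
    have h4 : (l ^ 2 * (z ⬝ᵥ z)) * (z ⬝ᵥ z) ≤ ((R *ᵥ z) ⬝ᵥ (R *ᵥ z)) * (z ⬝ᵥ z) := by nlinarith
    exact le_of_mul_le_mul_right h4 h0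

lemma posDef (h : SpectralBounds l u R) (hl : 0 < l) : R.PosDef := by
  refine Matrix.PosDef.of_dotProduct_mulVec_pos
    (by rw [Matrix.IsHermitian, conjTranspose_eq_transpose_of_trivial, h.symm]) fun z hz => ?_
  have h1 : 0 < z ⬝ᵥ z :=
    lt_of_le_of_ne (dotProduct_self_nonneg' z) fun h0 => hz (dotProduct_self_eq_zero.1 h0.symm)
  simpa using (mul_pos hl h1).trans_le (h.lower z)

variable [DecidableEq ι]

lemma isUnit_det (h : SpectralBounds l u R) (hl : 0 < l) : IsUnit R.det :=
  (h.posDef hl).det_pos.ne'.isUnit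

lemma inv_symm (h : SpectralBounds l u R) : (R⁻¹)ᵀ = R⁻¹ := by
  rw [transpose_nonsing_inv, h.symm]

lemma opSqLE_inv (h : SpectralBounds l u R) (hl : 0 < l) : OpSqLE ((l ^ 2)⁻¹) R⁻¹ := by
  intro z
  have := h.lower_sq hl (R⁻¹ *ᵥ z)
  rw [mulVec_mulVec, mul_nonsing_inv _ (h.isUnit_det hl), one_mulVec] at this
  rw [inv_mul_eq_div, le_div_iff₀ (by positivity)]
  linarith

/-- With `w = R⁻¹ eᵢ`, the diagonal entry is `w ⬝ᵥ R w ≥ l |w|²`, while `1 = |R w|² ≤ u² |w|²`. The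
other bound is Cauchy–Schwarz with the norm bound on `R⁻¹`. -/
lemma inv_diag_bounds (h : SpectralBounds l u R) (hl : 0 < l) (hu : 0 < u) (i : ι) :
    l / u ^ 2 ≤ R⁻¹ i i ∧ (R⁻¹ i i) ^ 2 ≤ (l ^ 2)⁻¹ := by
  set w := R⁻¹ *ᵥ Pi.single i 1 with hw
  have hRw : R *ᵥ w = Pi.single i 1 := by
    rw [hw, mulVec_mulVec, mul_nonsing_inv _ (h.isUnit_det hl), one_mulVec]
  have hd : R⁻¹ i i = w ⬝ᵥ (R *ᵥ w) := by
    rw [hRw]; simp [hw]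
  have hone : (Pi.single i (1 : ℝ) : ι → ℝ) ⬝ᵥ Pi.single i 1 = 1 := by simp
  constructor
  · have h1 := h.opSqLE hl hu w
    rw [hRw, hone] at h1
    rw [hd, div_le_iff₀ (by positivity)]
    have h2 := h.lower w
    nlinarith [mul_le_mul_of_nonneg_right h2 (sq_nonneg u)]
  · have h1 := h.opSqLE_inv hl (Pi.single i 1)
    rw [hone, mul_one] at h1
    have h2 := dotProduct_sq_le w (Pi.single i (1 : ℝ))
    rw [hone, mul_one] at h2
    rw [hd, hRw]
    exact h2.trans h1

end SpectralBounds

/-! ### Leave-one-out residuals: stability in the covariance matrix, in both directions -/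

section LooMatrix

variable [DecidableEq ι]

/-- The matrix mapping the data vector to the vector of leave-one-out residuals. -/
noncomputable def looMatrix (R : Matrix ι ι ℝ) : Matrix ι ι ℝ :=
  diagonal (fun i => (R⁻¹ i i)⁻¹) * R⁻¹

/-- The sum of the variances of the leave-one-out residuals computed from `R` when the data have
covariance matrix `R₀`. -/
noncomputable def looForm (R R₀ : Matrix ι ι ℝ) : ℝ :=
  ∑ i, looMatrix R i ⬝ᵥ (R₀ *ᵥ looMatrix R i)

/-- A common bound for the squared operator norms of `R`, `R⁻¹`, `diag R⁻¹` and its inverse. -/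
noncomputable def opBound (l u : ℝ) : ℝ := 1 + u ^ 2 + (l ^ 2)⁻¹ + (u ^ 2 / l) ^ 2

lemma one_le_opBound (l u : ℝ) : 1 ≤ opBound l u := by
  unfold opBound
  have : 0 ≤ u ^ 2 + (l ^ 2)⁻¹ + (u ^ 2 / l) ^ 2 := by positivity
  linarith

namespace SpectralBounds

variable {l u : ℝ} {R R₀ : Matrix ι ι ℝ}

omit [DecidableEq ι] in
lemma opSqLE_opBound (h : SpectralBounds l u R) (hl : 0 < l) (hu : 0 < u) :
    OpSqLE (opBound l u) R := by
  refine (h.opSqLE hl hu).mono ?_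
  unfold opBound
  have : 0 ≤ (l ^ 2)⁻¹ + (u ^ 2 / l) ^ 2 := by positivity
  linarith

lemma opSqLE_inv_opBound (h : SpectralBounds l u R) (hl : 0 < l) :
    OpSqLE (opBound l u) R⁻¹ := by
  refine (h.opSqLE_inv hl).mono ?_
  unfold opBound
  have : 0 ≤ u ^ 2 + (u ^ 2 / l) ^ 2 := by positivity
  linarith

lemma inv_diag_pos (h : SpectralBounds l u R) (hl : 0 < l) (hu : 0 < u) (i : ι) :
    0 < R⁻¹ i i :=
  (by positivity : 0 < l / u ^ 2).trans_le (h.inv_diag_bounds hl hu i).1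

lemma opSqLE_diag (h : SpectralBounds l u R) (hl : 0 < l) (hu : 0 < u) :
    OpSqLE (opBound l u) (diagonal fun i => R⁻¹ i i) := by
  refine OpSqLE.diagonal fun i => (h.inv_diag_bounds hl hu i).2.trans ?_
  unfold opBound
  have : 0 ≤ u ^ 2 + (u ^ 2 / l) ^ 2 := by positivity
  linarith

lemma opSqLE_diag_inv (h : SpectralBounds l u R) (hl : 0 < l) (hu : 0 < u) :
    OpSqLE (opBound l u) (diagonal fun i => (R⁻¹ i i)⁻¹) := by
  refine OpSqLE.diagonal fun i => ?_
  have h1 : (R⁻¹ i i)⁻¹ ≤ u ^ 2 / l := by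
    rw [← inv_div]
    exact inv_anti₀ (by positivity) (h.inv_diag_bounds hl hu i).1
  have h2 := pow_le_pow_left₀ (inv_pos.2 (h.inv_diag_pos hl hu i)).le h1 2
  refine h2.trans ?_
  unfold opBound
  have : 0 ≤ u ^ 2 + (l ^ 2)⁻¹ := by positivity
  linarith

lemma diag_mul_diag_inv (h : SpectralBounds l u R) (hl : 0 < l) (hu : 0 < u) :
    (diagonal fun i => R⁻¹ i i) * (diagonal fun i => (R⁻¹ i i)⁻¹) = 1 := by
  rw [diagonal_mul_diagonal, ← diagonal_one]
  congr 1
  ext i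
  exact mul_inv_cancel₀ (h.inv_diag_pos hl hu i).ne'

lemma diag_inv_mul_diag (h : SpectralBounds l u R) (hl : 0 < l) (hu : 0 < u) :
    (diagonal fun i => (R⁻¹ i i)⁻¹) * (diagonal fun i => R⁻¹ i i) = 1 := by
  rw [diagonal_mul_diagonal, ← diagonal_one]
  congr 1
  ext i
  exact inv_mul_cancel₀ (h.inv_diag_pos hl hu i).ne'

lemma looMatrix_apply_self (h : SpectralBounds l u R) (hl : 0 < l) (hu : 0 < u) (i : ι) :
    looMatrix R i i = 1 := by
  rw [looMatrix, diagonal_mul]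
  exact inv_mul_cancel₀ (h.inv_diag_pos hl hu i).ne'

lemma looMatrix_mul (h : SpectralBounds l u R) (hl : 0 < l) :
    looMatrix R * R = diagonal (fun i => (R⁻¹ i i)⁻¹) := by
  rw [looMatrix, mul_assoc, nonsing_inv_mul _ (h.isUnit_det hl), mul_one]

/-- Pythagoras: since `A₀ R₀` is diagonal, the vector `R₀ a₀` for the `i`-th row `a₀` of `A₀` is a
multiple of `eᵢ`. Both matrices have unit diagonal, so `a - a₀` vanishes at `i` and is orthogonal to
`a₀` for the form of `R₀`. -/
lemma looForm_sub (h : SpectralBounds l u R) (h₀ : SpectralBounds l u R₀) (hl : 0 < l)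
    (hu : 0 < u) :
    looForm R R₀ - looForm R₀ R₀ =
      ∑ i, (looMatrix R - looMatrix R₀) i ⬝ᵥ (R₀ *ᵥ (looMatrix R - looMatrix R₀) i) := by
  unfold looForm
  rw [← Finset.sum_sub_distrib]
  refine Finset.sum_congr rfl fun i _ => ?_
  set a := looMatrix R i with ha
  set a₀ := looMatrix R₀ i with ha₀
  have hsub : (looMatrix R - looMatrix R₀) i = a - a₀ := rfl
  have hR : R₀ *ᵥ a₀ = Pi.single i (R₀⁻¹ i i)⁻¹ := by
    have h1 : (looMatrix R₀ * R₀) i = a₀ ᵥ* R₀ := by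
      ext j; simp [Matrix.mul_apply, vecMul, dotProduct, ha₀]
    rw [← vecMul_transpose, h₀.symm, ← h1, h₀.looMatrix_mul hl]
    ext j
    simp [diagonal_apply, Pi.single_apply, eq_comm]
  have hd : (a - a₀) ⬝ᵥ (R₀ *ᵥ a₀) = 0 := by
    rw [hR]
    simp [ha, ha₀, h.looMatrix_apply_self hl hu, h₀.looMatrix_apply_self hl hu]
  have hc := h₀.form_comm (a - a₀) a₀
  have hexp : a ⬝ᵥ (R₀ *ᵥ a) = (a - a₀ + a₀) ⬝ᵥ (R₀ *ᵥ (a - a₀ + a₀)) := by simp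
  rw [hsub, hexp, mulVec_add, dotProduct_add, add_dotProduct, add_dotProduct, hd]
  rw [hd] at hc
  rw [← hc]
  ring

lemma frobSq_inv_sub_le (h : SpectralBounds l u R) (h₀ : SpectralBounds l u R₀)
    (hl : 0 < l) : frobSq (R⁻¹ - R₀⁻¹) ≤ opBound l u ^ 2 * frobSq (R - R₀) := by
  -- Resolvent identity; each inverse factor costs one `opBound`.
  have e : R⁻¹ - R₀⁻¹ = R⁻¹ * ((R₀ - R) * R₀⁻¹) := by
    rw [sub_mul, mul_nonsing_inv _ (h₀.isUnit_det hl), mul_sub, mul_one, ← mul_assoc,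
      nonsing_inv_mul _ (h.isUnit_det hl), one_mul]
  have hb := one_le_opBound l u
  calc frobSq (R⁻¹ - R₀⁻¹) ≤ opBound l u * frobSq ((R₀ - R) * R₀⁻¹) := by
        rw [e]; exact frobSq_mul_le (h.opSqLE_inv_opBound hl) _
    _ ≤ opBound l u * (opBound l u * frobSq (R₀ - R)) := by
        gcongr
        exact frobSq_mul_le' (h₀.opSqLE_inv_opBound hl) h₀.inv_symm _
    _ = _ := by rw [frobSq_sub_comm]; ring

lemma frobSq_diag_inv_sub_le (h : SpectralBounds l u R) (h₀ : SpectralBounds l u R₀)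
    (hl : 0 < l) (hu : 0 < u) :
    frobSq (diagonal (fun i => (R⁻¹ i i)⁻¹) - diagonal (fun i => (R₀⁻¹ i i)⁻¹)) ≤
      opBound l u ^ 2 * ∑ i, (R⁻¹ i i - R₀⁻¹ i i) ^ 2 := by
  set D := diagonal (fun i => R⁻¹ i i)
  set D₀ := diagonal (fun i => R₀⁻¹ i i)
  set E := diagonal (fun i => (R⁻¹ i i)⁻¹)
  set E₀ := diagonal (fun i => (R₀⁻¹ i i)⁻¹)
  have e : E - E₀ = E * ((D₀ - D) * E₀) := by
    rw [sub_mul, h₀.diag_mul_diag_inv hl hu, mul_sub, mul_one, ← mul_assoc,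
      h.diag_inv_mul_diag hl hu, one_mul]
  have hb := one_le_opBound l u
  have hD : frobSq (D₀ - D) = ∑ i, (R⁻¹ i i - R₀⁻¹ i i) ^ 2 := by
    rw [frobSq_sub_comm, diagonal_sub, frobSq_diagonal]
  calc frobSq (E - E₀) ≤ opBound l u * frobSq ((D₀ - D) * E₀) := by
        rw [e]; exact frobSq_mul_le (h.opSqLE_diag_inv hl hu) _
    _ ≤ opBound l u * (opBound l u * frobSq (D₀ - D)) := by
        gcongr
        exact frobSq_mul_le' (h₀.opSqLE_diag_inv hl hu) (diagonal_transpose _) _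
    _ = _ := by rw [hD]; ring

lemma frobSq_looMatrix_sub_le (h : SpectralBounds l u R) (h₀ : SpectralBounds l u R₀)
    (hl : 0 < l) (hu : 0 < u) :
    frobSq (looMatrix R - looMatrix R₀) ≤ 4 * opBound l u ^ 5 * frobSq (R - R₀) := by
  set b := opBound l u
  have hb : 1 ≤ b := one_le_opBound l u
  set E := diagonal (fun i => (R⁻¹ i i)⁻¹) with hE
  set E₀ := diagonal (fun i => (R₀⁻¹ i i)⁻¹) with hE₀
  have e : looMatrix R - looMatrix R₀ = E * (R⁻¹ - R₀⁻¹) + (E - E₀) * R₀⁻¹ := by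
    simp only [looMatrix, mul_sub, sub_mul, ← hE, ← hE₀]; abel
  have h1 := h.frobSq_inv_sub_le h₀ hl
  have h2 := h.frobSq_diag_inv_sub_le h₀ hl hu
  have h3 : ∑ i, (R⁻¹ i i - R₀⁻¹ i i) ^ 2 ≤ frobSq (R⁻¹ - R₀⁻¹) :=
    sum_diag_sq_le_frobSq (R⁻¹ - R₀⁻¹)
  have hF := frobSq_nonneg (R - R₀)
  have h4 : frobSq (E * (R⁻¹ - R₀⁻¹)) ≤ b * (b ^ 2 * frobSq (R - R₀)) :=
    (frobSq_mul_le (h.opSqLE_diag_inv hl hu) _).trans (by gcongr)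
  have h5 : frobSq ((E - E₀) * R₀⁻¹) ≤ b * (b ^ 2 * (b ^ 2 * frobSq (R - R₀))) := by
    refine (frobSq_mul_le' (h₀.opSqLE_inv_opBound hl) h₀.inv_symm _).trans ?_
    gcongr
    exact h2.trans (by gcongr; exact h3.trans h1)
  -- Since `b ≥ 1`, the smaller power is absorbed in the larger one.
  have h6 : b * (b ^ 2 * frobSq (R - R₀)) ≤ b ^ 5 * frobSq (R - R₀) := by
    have : b ^ 3 ≤ b ^ 5 := pow_le_pow_right₀ hb (by norm_num)
    nlinarith [mul_le_mul_of_nonneg_right this hF]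
  rw [e]
  refine (frobSq_add_le _ _).trans ?_
  nlinarith

/-- `A` alone determines `R` only up to a scalar, since it is invariant under scaling of `R`; the
unit diagonal removes this freedom. As `A⁻¹ = R D` with `D = diag(R⁻¹)`, closeness of `A` and `A₀`
gives closeness of `R D` and `R₀ D₀`. The diagonals of these are those of `D` and `D₀`, so `D` is
close to `D₀`, and then `R` to `R₀`. -/
lemma frobSq_sub_le_looMatrix (h : SpectralBounds l u R) (h₀ : SpectralBounds l u R₀)
    (hl : 0 < l) (hu : 0 < u) (hd : ∀ i, R i i = 1) (hd₀ : ∀ i, R₀ i i = 1) :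
    frobSq (R - R₀) ≤ 4 * opBound l u ^ 8 * frobSq (looMatrix R - looMatrix R₀) := by
  set b := opBound l u
  have hb : 1 ≤ b := one_le_opBound l u
  set D := diagonal (fun i => R⁻¹ i i) with hD
  set D₀ := diagonal (fun i => R₀⁻¹ i i) with hD₀
  set E := diagonal (fun i => (R⁻¹ i i)⁻¹) with hE
  set E₀ := diagonal (fun i => (R₀⁻¹ i i)⁻¹) with hE₀
  set A := looMatrix R with hA
  set A₀ := looMatrix R₀ with hA₀
  set X := frobSq (A - A₀)
  have hX : 0 ≤ X := frobSq_nonneg _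
  have hinv : R * D * A = 1 := by
    rw [hA, looMatrix, mul_assoc, ← mul_assoc D, h.diag_mul_diag_inv hl hu, one_mul,
      mul_nonsing_inv _ (h.isUnit_det hl)]
  have hinv₀ : A₀ * (R₀ * D₀) = 1 := by
    rw [hA₀, ← mul_assoc, h₀.looMatrix_mul hl, h₀.diag_inv_mul_diag hl hu]
  have e1 : R * D - R₀ * D₀ = R * (D * ((A₀ - A) * R₀ * D₀)) := by
    rw [mul_assoc (A₀ - A), sub_mul, hinv₀, mul_sub, mul_sub, mul_one, ← mul_assoc D A,
      ← mul_assoc R (D * A), ← mul_assoc R D A, hinv, one_mul]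
  have h1 : frobSq (R * D - R₀ * D₀) ≤ b ^ 4 * X := by
    rw [e1]
    calc frobSq (R * (D * ((A₀ - A) * R₀ * D₀)))
        ≤ b * frobSq (D * ((A₀ - A) * R₀ * D₀)) := frobSq_mul_le (h.opSqLE_opBound hl hu) _
      _ ≤ b * (b * frobSq ((A₀ - A) * R₀ * D₀)) := by
          gcongr; exact frobSq_mul_le (h.opSqLE_diag hl hu) _
      _ ≤ b * (b * (b * frobSq ((A₀ - A) * R₀))) := by
          gcongr; exact frobSq_mul_le' (h₀.opSqLE_diag hl hu) (diagonal_transpose _) _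
      _ ≤ b * (b * (b * (b * frobSq (A₀ - A)))) := by
          gcongr; exact frobSq_mul_le' (h₀.opSqLE_opBound hl hu) h₀.symm _
      _ = b ^ 4 * X := by rw [frobSq_sub_comm]; ring
  have h2 : ∑ i, (R⁻¹ i i - R₀⁻¹ i i) ^ 2 ≤ frobSq (R * D - R₀ * D₀) := by
    refine le_trans (le_of_eq ?_) (sum_diag_sq_le_frobSq _)
    refine Finset.sum_congr rfl fun i _ => ?_
    rw [Matrix.sub_apply, hD, hD₀, mul_diagonal, mul_diagonal, hd, hd₀, one_mul, one_mul]
  have h3 : frobSq (E - E₀) ≤ b ^ 2 * (b ^ 4 * X) :=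
    (h.frobSq_diag_inv_sub_le h₀ hl hu).trans (by gcongr; exact h2.trans h1)
  have e2 : R - R₀ = (R * D - R₀ * D₀) * E + R₀ * (D₀ * (E - E₀)) := by
    rw [sub_mul, mul_assoc R, h.diag_mul_diag_inv hl hu, mul_sub D₀,
      h₀.diag_mul_diag_inv hl hu, mul_sub R₀, mul_one, mul_one, mul_assoc R₀]
    abel
  have h4 : frobSq ((R * D - R₀ * D₀) * E) ≤ b * (b ^ 4 * X) :=
    (frobSq_mul_le' (h.opSqLE_diag_inv hl hu) (diagonal_transpose _) _).trans (by gcongr)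
  have h5 : frobSq (R₀ * (D₀ * (E - E₀))) ≤ b * (b * (b ^ 2 * (b ^ 4 * X))) := by
    refine (frobSq_mul_le (h₀.opSqLE_opBound hl hu) _).trans ?_
    gcongr
    refine (frobSq_mul_le (h₀.opSqLE_diag hl hu) _).trans ?_
    gcongr
  have h6 : b * (b ^ 4 * X) ≤ b ^ 8 * X := by
    have : b ^ 5 ≤ b ^ 8 := pow_le_pow_right₀ hb (by norm_num)
    nlinarith [mul_le_mul_of_nonneg_right this hX]
  rw [e2]
  refine (frobSq_add_le _ _).trans ?_
  nlinarith

omit [DecidableEq ι] in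
lemma sum_dotProduct_self (M : Matrix ι ι ℝ) : ∑ i, M i ⬝ᵥ M i = frobSq M := by
  simp [frobSq, dotProduct, sq]

lemma looForm_sub_le (h : SpectralBounds l u R) (h₀ : SpectralBounds l u R₀) (hl : 0 < l)
    (hu : 0 < u) :
    looForm R R₀ - looForm R₀ R₀ ≤ u * (4 * opBound l u ^ 5) * frobSq (R - R₀) := by
  rw [h.looForm_sub h₀ hl hu, mul_assoc]
  refine le_trans ?_ (mul_le_mul_of_nonneg_left (h.frobSq_looMatrix_sub_le h₀ hl hu) hu.le)
  rw [← sum_dotProduct_self, Finset.mul_sum]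
  exact Finset.sum_le_sum fun i _ => h₀.upper _

lemma le_looForm_sub (h : SpectralBounds l u R) (h₀ : SpectralBounds l u R₀) (hl : 0 < l)
    (hu : 0 < u) (hd : ∀ i, R i i = 1) (hd₀ : ∀ i, R₀ i i = 1) :
    l / (4 * opBound l u ^ 8) * frobSq (R - R₀) ≤ looForm R R₀ - looForm R₀ R₀ := by
  have hb := one_le_opBound l u
  have h1 := h.frobSq_sub_le_looMatrix h₀ hl hu hd hd₀
  rw [h.looForm_sub h₀ hl hu]
  have h2 : l * frobSq (looMatrix R - looMatrix R₀) ≤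
      ∑ i, (looMatrix R - looMatrix R₀) i ⬝ᵥ (R₀ *ᵥ (looMatrix R - looMatrix R₀) i) := by
    rw [← sum_dotProduct_self, Finset.mul_sum]
    exact Finset.sum_le_sum fun i _ => h₀.lower _
  refine le_trans ?_ h2
  rw [div_mul_eq_mul_div, div_le_iff₀ (by positivity), mul_assoc]
  refine mul_le_mul_of_nonneg_left ?_ hl.le
  linarith

lemma looForm_nonneg (h₀ : SpectralBounds l u R₀) (hl : 0 < l) : 0 ≤ looForm R R₀ :=
  Finset.sum_nonneg fun i _ =>
    (mul_nonneg hl.le (dotProduct_self_nonneg' _)).trans (h₀.lower (looMatrix R i))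

lemma looForm_self_le (h₀ : SpectralBounds l u R₀) (hl : 0 < l) (hu : 0 < u) :
    looForm R₀ R₀ ≤ u * (opBound l u ^ 2 * Fintype.card ι) := by
  have hb := one_le_opBound l u
  have h1 : looForm R₀ R₀ ≤ u * frobSq (looMatrix R₀) := by
    rw [← sum_dotProduct_self, Finset.mul_sum]
    exact Finset.sum_le_sum fun i _ => h₀.upper _
  have h2 : frobSq (1 : Matrix ι ι ℝ) = Fintype.card ι := by
    rw [← diagonal_one, frobSq_diagonal]; simp
  refine h1.trans (mul_le_mul_of_nonneg_left ?_ hu.le)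
  calc frobSq (looMatrix R₀) ≤ opBound l u * frobSq (R₀⁻¹ * 1) := by
        rw [looMatrix, mul_one]; exact frobSq_mul_le (h₀.opSqLE_diag_inv hl hu) _
    _ ≤ opBound l u * (opBound l u * frobSq (1 : Matrix ι ι ℝ)) := by
        gcongr; exact frobSq_mul_le (h₀.opSqLE_inv_opBound hl) _
    _ = _ := by rw [h2]; ring

end SpectralBounds

end LooMatrix

end MatrixBounds

/-! ### The Kriging prediction as a linear map, and the mean squared error at fixed points -/

section Gaussian

open Matrix
open scoped MatrixOrder

/-- Used in both directions between the standard Gaussian and Lebesgue measure on the line;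
induction splits off one coordinate. -/
lemma pi_absolutelyContinuous_pi {μ ν : Measure ℝ} [SigmaFinite μ] [SigmaFinite ν] (h : μ ≪ ν) :
    ∀ n : ℕ, Measure.pi (fun _ : Fin n => μ) ≪ Measure.pi (fun _ : Fin n => ν)
  | 0 => by
    rw [Measure.pi_of_empty, Measure.pi_of_empty]
  | n + 1 => by
    have hμ := measurePreserving_piFinSuccAbove (fun _ : Fin (n + 1) => μ) 0
    have hν := measurePreserving_piFinSuccAbove (fun _ : Fin (n + 1) => ν) 0
    have h1 := (h.prod (pi_absolutelyContinuous_pi h n)).map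
      (MeasurableEquiv.piFinSuccAbove (fun _ : Fin (n + 1) => ℝ) 0).symm.measurable
    have e1 := (hμ.symm _).map_eq
    have e2 := (hν.symm _).map_eq
    rw [e1, e2] at h1
    exact h1

variable {n : ℕ}

lemma volume_absolutelyContinuous_stdGaussian :
    (volume : Measure (EuclideanSpace ℝ (Fin n))) ≪ stdGaussian (EuclideanSpace ℝ (Fin n)) := by
  rw [← map_pi_eq_stdGaussian, ← (PiLp.volume_preserving_toLp (Fin n)).map_eq]
  refine Measure.AbsolutelyContinuous.map ?_ (by fun_prop)
  exact pi_absolutelyContinuous_pi (gaussianReal_absolutelyContinuous' 0 one_ne_zero) n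

lemma stdGaussian_absolutelyContinuous_volume :
    stdGaussian (EuclideanSpace ℝ (Fin n)) ≪ (volume : Measure (EuclideanSpace ℝ (Fin n))) := by
  rw [← map_pi_eq_stdGaussian, ← (PiLp.volume_preserving_toLp (Fin n)).map_eq]
  refine Measure.AbsolutelyContinuous.map ?_ (by fun_prop)
  exact pi_absolutelyContinuous_pi (gaussianReal_absolutelyContinuous 0 one_ne_zero) n

lemma det_toEuclideanCLM_sqrt_ne_zero {R : Matrix (Fin n) (Fin n) ℝ} (hR : R.PosDef) :
    LinearMap.det ((toEuclideanCLM (𝕜 := ℝ) (CFC.sqrt R) :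
      EuclideanSpace ℝ (Fin n) →L[ℝ] EuclideanSpace ℝ (Fin n)) :
      EuclideanSpace ℝ (Fin n) →ₗ[ℝ] EuclideanSpace ℝ (Fin n)) ≠ 0 := by
  have h1 : CFC.sqrt R * CFC.sqrt R = R :=
    CFC.sqrt_mul_sqrt_self R (Matrix.nonneg_iff_posSemidef.2 hR.posSemidef)
  have h2 : toEuclideanCLM (𝕜 := ℝ) (CFC.sqrt R) * toEuclideanCLM (𝕜 := ℝ) (CFC.sqrt R) *
      toEuclideanCLM (𝕜 := ℝ) R⁻¹ = 1 := by
    rw [← map_mul, h1, ← map_mul, mul_nonsing_inv _ hR.det_pos.ne'.isUnit, map_one]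
  intro h0
  have h3 := congrArg (fun f : EuclideanSpace ℝ (Fin n) →L[ℝ] EuclideanSpace ℝ (Fin n) =>
    LinearMap.det (f : EuclideanSpace ℝ (Fin n) →ₗ[ℝ] EuclideanSpace ℝ (Fin n))) h2
  simp only [ContinuousLinearMap.toLinearMap_mul, map_mul, h0, zero_mul, ContinuousLinearMap.toLinearMap_one,
    map_one] at h3
  exact zero_ne_one h3

lemma map_linear_volume_equiv {R : Matrix (Fin n) (Fin n) ℝ} (hR : R.PosDef) :
    ∃ c : ℝ≥0∞, c ≠ 0 ∧ (volume : Measure (EuclideanSpace ℝ (Fin n))).map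
      (toEuclideanCLM (𝕜 := ℝ) (CFC.sqrt R)) = c • volume := by
  have h0 := det_toEuclideanCLM_sqrt_ne_zero hR
  refine ⟨_, ?_, Measure.map_linearMap_addHaar_eq_smul_addHaar volume h0⟩
  simp [h0]

lemma volume_absolutelyContinuous_multivariateGaussian {R : Matrix (Fin n) (Fin n) ℝ}
    (hR : R.PosDef) : volume ≪ multivariateGaussian 0 R := by
  obtain ⟨c, hc, h⟩ := map_linear_volume_equiv hR
  have h1 := (volume_absolutelyContinuous_stdGaussian (n := n)).map
    (f := toEuclideanCLM (𝕜 := ℝ) (CFC.sqrt R)) (by fun_prop)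
  rw [h] at h1
  simp only [multivariateGaussian, zero_add]
  exact (Measure.absolutelyContinuous_smul hc).trans h1

lemma multivariateGaussian_absolutelyContinuous_volume {R : Matrix (Fin n) (Fin n) ℝ}
    (hR : R.PosDef) : multivariateGaussian 0 R ≪ volume := by
  obtain ⟨c, hc, h⟩ := map_linear_volume_equiv hR
  have h1 := (stdGaussian_absolutelyContinuous_volume (n := n)).map
    (f := toEuclideanCLM (𝕜 := ℝ) (CFC.sqrt R)) (by fun_prop)
  rw [h] at h1
  simp only [multivariateGaussian, zero_add]
  exact h1.trans Measure.smul_absolutelyContinuous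

lemma memLp_two_eval {R : Matrix (Fin n) (Fin n) ℝ} (i : Fin n) :
    MemLp (fun y : EuclideanSpace ℝ (Fin n) => y i) 2 (multivariateGaussian 0 R) :=
  ((IsGaussian.hasGaussianLaw_id (μ := multivariateGaussian 0 R)).map_fun
    (EuclideanSpace.proj i)).memLp_two

/-- This covariance is the entry `(i, j)` of `A R`, which is a diagonal matrix. -/
lemma looResidual_covariance {l u : ℝ} {R : Matrix (Fin n) (Fin n) ℝ}
    (hR : SpectralBounds l u R) (hl : 0 < l) {i j : Fin n} (hij : j ≠ i) :
    cov[fun y : EuclideanSpace ℝ (Fin n) => ∑ k, looMatrix R i k * y k, fun y => y j;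
      multivariateGaussian 0 R] = 0 := by
  rw [covariance_fun_sum_left (fun k => (memLp_two_eval k).const_mul _) (memLp_two_eval j)]
  simp_rw [covariance_const_mul_left,
    covariance_eval_multivariateGaussian (hR.posDef hl).posSemidef]
  rw [← Matrix.mul_apply, hR.looMatrix_mul hl, diagonal_apply_ne _ hij.symm]

/-- The residual and the remaining coordinates are jointly Gaussian and uncorrelated. The residual
is viewed as a family indexed by `Unit` to apply the criterion for two families. -/
lemma looResidual_indep {l u : ℝ} {R : Matrix (Fin n) (Fin n) ℝ}
    (hR : SpectralBounds l u R) (hl : 0 < l) (i : Fin n) :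
    IndepFun (fun y : EuclideanSpace ℝ (Fin n) => ∑ k, looMatrix R i k * y k)
      (fun (y : EuclideanSpace ℝ (Fin n)) (j : {j : Fin n // j ≠ i}) => y j)
      (multivariateGaussian 0 R) := by
  let L : EuclideanSpace ℝ (Fin n) →L[ℝ] (Unit → ℝ) × ({j : Fin n // j ≠ i} → ℝ) :=
    (ContinuousLinearMap.pi fun _ : Unit =>
      ∑ k, looMatrix R i k • (EuclideanSpace.proj k : EuclideanSpace ℝ (Fin n) →L[ℝ] ℝ)).prod
    (ContinuousLinearMap.pi fun j : {j : Fin n // j ≠ i} => EuclideanSpace.proj j.1)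
  have hG : HasGaussianLaw (fun y : EuclideanSpace ℝ (Fin n) =>
      ((fun _ : Unit => ∑ k, looMatrix R i k * y k), fun j : {j : Fin n // j ≠ i} => y j))
      (multivariateGaussian 0 R) := by
    have := (IsGaussian.hasGaussianLaw_id (μ := multivariateGaussian 0 R)).map_fun L
    have hL : (fun y : EuclideanSpace ℝ (Fin n) => L (id y)) = fun y =>
        ((fun _ : Unit => ∑ k, looMatrix R i k * y k), fun j : {j : Fin n // j ≠ i} => y j) := by
      ext y
      · simp [L]
      · simp [L]
    rwa [hL] at this
  have h := hG.indepFun_of_covariance_eval (X := fun (_ : Unit) (y : EuclideanSpace ℝ (Fin n)) =>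
    ∑ k, looMatrix R i k * y k) (Y := fun (j : {j : Fin n // j ≠ i}) y => y j)
    fun _ j => looResidual_covariance hR hl j.2
  exact h.comp (φ := fun f : Unit → ℝ => f ()) (ψ := id) (measurable_pi_apply ()) measurable_id

lemma condExp_add_of_indep {Ω : Type*} {m m0 : MeasurableSpace Ω} {ν : Measure Ω}
    [IsProbabilityMeasure ν] (hm : m ≤ m0) {f e : Ω → ℝ} (hf : StronglyMeasurable[m] f)
    (hfi : Integrable f ν) (he : Measurable[m0] e) (hei : Integrable e ν) (hmean : ν[e] = 0)
    (hind : Indep (MeasurableSpace.comap e inferInstance) m ν) : ν[f + e | m] =ᵐ[ν] f := by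
  have hce : ν[e | m] =ᵐ[ν] fun _ => ν[e] :=
    condExp_indep_eq he.comap_le hm (Measurable.stronglyMeasurable (comap_measurable e)) hind
  have hadd : ν[f + e | m] =ᵐ[ν] ν[f | m] + ν[e | m] := condExp_add hfi hei m
  rw [condExp_of_stronglyMeasurable hm hf hfi] at hadd
  filter_upwards [hadd, hce] with y h1 h2
  rw [h1, Pi.add_apply, h2, hmean, add_zero]

/-- The coordinate `y i` is a function of the other coordinates plus a centered residual independent
of them, so that function is the conditional expectation. The statement is for Lebesgue measure
because the prediction is defined up to null sets of the law with covariance `k`, but is evaluated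
on data with another covariance; both laws are equivalent to Lebesgue measure. -/
lemma krigingPred_ae_eq {d : ℕ} {k : EuclideanSpace ℝ (Fin d) → ℝ}
    {s : Fin n → EuclideanSpace ℝ (Fin d)} {l u : ℝ}
    (hR : SpectralBounds l u (covMatrix k s)) (hl : 0 < l) (hu : 0 < u) (i : Fin n) :
    ∀ᵐ y : EuclideanSpace ℝ (Fin n),
      y i - krigingPred k s i y = ∑ j, looMatrix (covMatrix k s) i j * y j := by
  refine (volume_absolutelyContinuous_multivariateGaussian (hR.posDef hl)).ae_le ?_
  set R := covMatrix k s
  set A := looMatrix R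
  set ν := multivariateGaussian 0 R with hν
  set pr := fun (y : EuclideanSpace ℝ (Fin n)) (j : {j : Fin n // j ≠ i}) => y j with hpr
  have hprm : Measurable pr := by fun_prop
  set e := fun y : EuclideanSpace ℝ (Fin n) => ∑ j, A i j * y j with he
  set f := fun y : EuclideanSpace ℝ (Fin n) => y i - e y with hf
  have hem : Measurable e := by rw [he]; fun_prop
  have hint : ∀ j, Integrable (fun y : EuclideanSpace ℝ (Fin n) => y j) ν :=
    fun j => (memLp_two_eval j).integrable (by norm_num)
  have he_int : Integrable e ν := integrable_finsetSum _ fun j _ => (hint j).const_mul _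
  have hf_int : Integrable f ν := (hint i).sub he_int
  have hfm : StronglyMeasurable[MeasurableSpace.comap pr MeasurableSpace.pi] f := by
    -- As `A i i = 1`, the coordinate `y i` cancels in `f`.
    have : f = (fun z : {j : Fin n // j ≠ i} → ℝ =>
        -∑ j : {j : Fin n // j ≠ i}, A i j * z j) ∘ pr := by
      ext y
      have h1 := Fintype.sum_subtype_add_sum_subtype (fun j => j ≠ i) (fun j => A i j * y j)
      have h2 : ∑ j : {j : Fin n // ¬ j ≠ i}, A i j * y j = y i := by
        rw [Fintype.sum_eq_single (⟨i, by simp⟩ : {j : Fin n // ¬ j ≠ i})]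
        · simp [A, hR.looMatrix_apply_self hl hu]
        · rintro ⟨j, hj⟩ h; exact absurd (Subtype.ext (not_not.1 hj)) h
      simp only [hf, he, Function.comp_apply, hpr]
      linarith
    rw [this]
    exact (Measurable.stronglyMeasurable (by fun_prop)).comp_measurable (comap_measurable pr)
  have hmean : ν[e] = 0 := by
    have hid : ∀ j, ∫ y, y j ∂ν = 0 := by
      intro j
      have h1 := (EuclideanSpace.proj j : EuclideanSpace ℝ (Fin n) →L[ℝ] ℝ).integral_comp_comm
        (IsGaussian.integrable_id (μ := ν))
      simpa [hν] using h1
    rw [he, integral_finsetSum _ fun j _ => (hint j).const_mul _]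
    simp [integral_const_mul, hid]
  have hsum : f + e = fun y => y i := by ext y; simp [hf]
  have key := condExp_add_of_indep hprm.comap_le hfm hf_int hem he_int hmean
    (looResidual_indep hR hl i)
  rw [hsum] at key
  filter_upwards [key] with y h1
  have h3 : krigingPred k s i y = f y := h1
  rw [h3]
  exact sub_sub_cancel _ _

lemma map_field_eq_multivariateGaussian {d : ℕ} {Ω : Type*} [MeasurableSpace Ω]
    {k : EuclideanSpace ℝ (Fin d) → ℝ} {Y : EuclideanSpace ℝ (Fin d) → Ω → ℝ} {P : Measure Ω}
    (hY : IsCenteredGaussianField k Y P) (s : Fin n → EuclideanSpace ℝ (Fin d))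
    (hR : (covMatrix k s).PosSemidef) :
    P.map (fun ω => (WithLp.toLp 2 fun i => Y (s i) ω : EuclideanSpace ℝ (Fin n))) =
      multivariateGaussian 0 (covMatrix k s) := by
  have hP := hY.gaussian.isProbabilityMeasure
  have hG : HasGaussianLaw
      (fun ω => (WithLp.toLp 2 fun i => Y (s i) ω : EuclideanSpace ℝ (Fin n))) P := by
    have h1 := (hY.gaussian.comp_right s).hasGaussianLaw Finset.univ
    let L : (↥(Finset.univ : Finset (Fin n)) → ℝ) →L[ℝ] EuclideanSpace ℝ (Fin n) :=
      (PiLp.continuousLinearEquiv 2 ℝ (fun _ : Fin n => ℝ)).symm.toContinuousLinearMap.comp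
        (ContinuousLinearMap.pi fun i => ContinuousLinearMap.proj ⟨i, Finset.mem_univ i⟩)
    exact h1.map_fun L
  have hm : ∀ i, MemLp (Y (s i)) 2 P := fun i => (hY.gaussian.hasGaussianLaw_eval (s i)).memLp_two
  have := hG.isGaussian_map
  refine IsGaussian.ext ?_ ?_
  · rw [integral_map hG.aemeasurable (by fun_prop)]
    simp only [id_eq, integral_id_multivariateGaussian]
    ext i
    have h1 := (EuclideanSpace.proj i : EuclideanSpace ℝ (Fin n) →L[ℝ] ℝ).integral_comp_comm
      hG.integrable
    have h2 := hY.centered (s i)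
    exact h1.symm.trans h2
  · ext x y
    rw [covarianceBilin_multivariateGaussian hR,
      covarianceBilin_apply_pi (X := fun i => Y (s i)) hm]
    simp only [hY.covariance, dotProduct, mulVec, covMatrix, Matrix.of_apply, Finset.mul_sum]
    refine Finset.sum_congr rfl fun i _ => Finset.sum_congr rfl fun j _ => ?_
    ring

/-- The mean squared leave-one-out error at fixed observation points. -/
lemma lintegral_loo_eq {d : ℕ} {Ω : Type*} [MeasurableSpace Ω]
    {k k₀ : EuclideanSpace ℝ (Fin d) → ℝ} {Y : EuclideanSpace ℝ (Fin d) → Ω → ℝ} {P : Measure Ω}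
    (hY : IsCenteredGaussianField k₀ Y P) (s : Fin n → EuclideanSpace ℝ (Fin d)) {l u : ℝ}
    (hl : 0 < l) (hu : 0 < u) (hR : SpectralBounds l u (covMatrix k s))
    (hR₀ : SpectralBounds l u (covMatrix k₀ s)) :
    ∫⁻ ω, ENNReal.ofReal ((1 / (n : ℝ)) * ∑ i : Fin n, (Y (s i) ω -
        krigingPred k s i (WithLp.toLp 2 fun i => Y (s i) ω)) ^ 2) ∂P =
      ENNReal.ofReal ((1 / (n : ℝ)) * looForm (covMatrix k s) (covMatrix k₀ s)) := by
  have hP := hY.gaussian.isProbabilityMeasure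
  have hps := (hR₀.posDef hl).posSemidef
  have hmap := map_field_eq_multivariateGaussian hY s hps
  set y : Ω → EuclideanSpace ℝ (Fin n) := fun ω => WithLp.toLp 2 fun i => Y (s i) ω with hy
  have hym : AEMeasurable y P := by
    -- The push-forward by a map that is not a.e. measurable is zero by convention, whereas this one
    -- is a probability measure.
    refine AEMeasurable.of_map_ne_zero ?_
    rw [hmap]
    exact IsProbabilityMeasure.ne_zero _
  set A := looMatrix (covMatrix k s)
  have hm : ∀ i, MemLp (Y (s i)) 2 P := fun i => (hY.gaussian.hasGaussianLaw_eval (s i)).memLp_two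
  have hres : ∀ᵐ ω ∂P, ∀ i, y ω i - krigingPred k s i (y ω) = ∑ j, A i j * y ω j := by
    refine ae_of_ae_map (p := fun z : EuclideanSpace ℝ (Fin n) =>
      ∀ i, z i - krigingPred k s i z = ∑ j, A i j * z j) hym ?_
    rw [hmap]
    refine (multivariateGaussian_absolutelyContinuous_volume (hR₀.posDef hl)).ae_le ?_
    exact ae_all_iff.2 fun i => krigingPred_ae_eq hR hl hu i
  have hL2 : ∀ i, MemLp (fun ω => ∑ j, A i j * Y (s j) ω) 2 P := fun i =>
    memLp_finsetSum _ fun j _ => (hm j).const_mul _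
  have hmean : ∀ i, ∫ ω, ∑ j, A i j * Y (s j) ω ∂P = 0 := by
    intro i
    rw [integral_finsetSum _ fun j _ => ((hm j).integrable (by norm_num)).const_mul _]
    simp [integral_const_mul, hY.centered]
  have hvar : ∀ i, ∫ ω, (∑ j, A i j * Y (s j) ω) ^ 2 ∂P =
      A i ⬝ᵥ (covMatrix k₀ s *ᵥ A i) := by
    intro i
    rw [← variance_of_integral_eq_zero (hL2 i).aemeasurable (hmean i),
      ← covariance_self (hL2 i).aemeasurable,
      covariance_fun_sum_fun_sum (fun j => (hm j).const_mul _) (fun j => (hm j).const_mul _)]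
    simp only [covariance_const_mul_left, covariance_const_mul_right, hY.covariance, dotProduct,
      mulVec, covMatrix, Matrix.of_apply, Finset.mul_sum]
    refine Finset.sum_congr rfl fun i _ => Finset.sum_congr rfl fun j _ => ?_
    ring
  have hae : (fun ω => ENNReal.ofReal ((1 / (n : ℝ)) * ∑ i : Fin n, (Y (s i) ω -
        krigingPred k s i (y ω)) ^ 2)) =ᵐ[P]
      fun ω => ENNReal.ofReal ((1 / (n : ℝ)) * ∑ i : Fin n, (∑ j, A i j * Y (s j) ω) ^ 2) := by
    filter_upwards [hres] with ω h
    congr 2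
    exact Finset.sum_congr rfl fun i _ => congrArg (· ^ 2) (h i)
  rw [lintegral_congr_ae hae, ← ofReal_integral_eq_lintegral_ofReal]
  · rw [integral_const_mul, integral_finsetSum _ fun i _ => (hL2 i).integrable_sq]
    simp only [hvar]
    rfl
  · exact (integrable_finsetSum _ fun i _ => (hL2 i).integrable_sq).const_mul _
  · exact Eventually.of_forall fun ω => mul_nonneg (by positivity)
      (Finset.sum_nonneg fun i _ => sq_nonneg _)

end Gaussian

/-! ### Lattice sums and the Schur test for separated points -/

section Lattice

lemma summable_lattice_decay (d : ℕ) :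
    Summable fun w : Fin d → ℤ => ‖w‖⁻¹ ^ (d + 1) := by
  -- The integer points form a lattice of rank `d`, so the exponent `d + 1` suffices. The norm is
  -- the sup norm, and the term at `0` is `0`.
  let L : Submodule ℤ (Fin d → ℝ) := Submodule.span ℤ (Set.range (Pi.basisFun ℝ (Fin d)))
  have hrank : Module.finrank ℤ L = d := by
    rw [ZLattice.rank ℝ L, Module.finrank_fin_fun]
  have h := ZLattice.summable_norm_pow_inv L (d + 1) (by omega)
  let φ : (Fin d → ℤ) → L := fun w => ⟨fun i => (w i : ℝ), by
    rw [(Pi.basisFun ℝ (Fin d)).mem_span_iff_repr_mem ℤ]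
    intro i
    exact ⟨w i, by simp⟩⟩
  have hφ : Function.Injective φ := by
    intro w w' hw
    ext i
    have : ((w i : ℤ) : ℝ) = (w' i : ℤ) := congrFun (congrArg Subtype.val hw) i
    exact_mod_cast this
  have hn : ∀ w, ‖φ w‖ = ‖w‖ := by
    intro w
    change ‖(fun i => (w i : ℝ))‖ = ‖w‖
    simp [Pi.norm_def, Int.norm_eq_abs, nnnorm]
  refine (h.comp_injective hφ).congr fun w => ?_
  rw [Function.comp_apply, hn]

/-- The sum `∑_{w ∈ ℤ^d, w ≠ 0} ‖w‖^{-(d+1)}`. -/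
noncomputable def latticeSum (d : ℕ) : ℝ := ∑' w : Fin d → ℤ, ‖w‖⁻¹ ^ (d + 1)

lemma latticeSum_nonneg (d : ℕ) : 0 ≤ latticeSum d := tsum_nonneg fun _ => by positivity

/-- The points `s i` are indexed by distinct lattice points, whose distances they respect up to the
factor `c`. -/
def IsLatticeSeparated {d n : ℕ} (c : ℝ) (s : Fin n → EuclideanSpace ℝ (Fin d)) : Prop :=
  ∃ v : Fin n → Fin d → ℤ, Function.Injective v ∧ ∀ i j, c * ‖v i - v j‖ ≤ ‖s i - s j‖

variable {d n : ℕ} {c : ℝ} {s : Fin n → EuclideanSpace ℝ (Fin d)}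

/-- For fixed `i` the vectors `v i - v j` are distinct and nonzero, so the row sum is bounded by
part of the lattice sum. -/
lemma IsLatticeSeparated.sum_abs_le (hs : IsLatticeSeparated c s) (hc : 0 < c)
    {h : EuclideanSpace ℝ (Fin d) → ℝ} {C : ℝ} (hC : 0 ≤ C)
    (hh : ∀ t, t ≠ 0 → |h t| ≤ C * ‖t‖⁻¹ ^ (d + 1)) (i : Fin n) :
    ∑ j ∈ Finset.univ.erase i, |h (s i - s j)| ≤ C * c⁻¹ ^ (d + 1) * latticeSum d := by
  obtain ⟨v, hv, hvs⟩ := hs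
  have h1 : ∀ j ∈ Finset.univ.erase i, |h (s i - s j)| ≤
      C * c⁻¹ ^ (d + 1) * ‖v i - v j‖⁻¹ ^ (d + 1) := by
    intro j hj
    have hne : v i - v j ≠ 0 := sub_ne_zero.2 fun e => (Finset.ne_of_mem_erase hj) (hv e).symm
    have hpos : 0 < c * ‖v i - v j‖ := mul_pos hc (norm_pos_iff.2 hne)
    have hs0 : 0 < ‖s i - s j‖ := hpos.trans_le (hvs i j)
    refine (hh _ (norm_pos_iff.1 hs0)).trans ?_
    rw [mul_assoc, ← mul_pow, ← mul_inv]
    have := inv_anti₀ hpos (hvs i j)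
    gcongr
  refine (Finset.sum_le_sum h1).trans ?_
  rw [← Finset.mul_sum]
  refine mul_le_mul_of_nonneg_left ?_ (by positivity)
  have hinj : Set.InjOn (fun j => v i - v j) (Finset.univ.erase i) := by
    intro a _ b _ hab
    exact hv (sub_right_injective hab)
  rw [← Finset.sum_image (f := fun w : Fin d → ℤ => ‖w‖⁻¹ ^ (d + 1)) hinj]
  exact (summable_lattice_decay d).sum_le_tsum _ fun _ _ => by positivity

/-- Schur test for the off-diagonal part of a stationary kernel. -/
lemma IsLatticeSeparated.abs_offdiag_le (hs : IsLatticeSeparated c s) (hc : 0 < c)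
    {h : EuclideanSpace ℝ (Fin d) → ℝ} {C : ℝ} (hC : 0 ≤ C)
    (hh : ∀ t, t ≠ 0 → |h t| ≤ C * ‖t‖⁻¹ ^ (d + 1)) (z : Fin n → ℝ) :
    |∑ i, ∑ j ∈ Finset.univ.erase i, z i * z j * h (s i - s j)| ≤
      C * c⁻¹ ^ (d + 1) * latticeSum d * ∑ i, z i ^ 2 := by
  set B := C * c⁻¹ ^ (d + 1) * latticeSum d
  have h2 : ∀ i j, |z i * z j * h (s i - s j)| ≤
      (z i ^ 2 / 2) * |h (s i - s j)| + (z j ^ 2 / 2) * |h (s i - s j)| := by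
    intro i j
    rw [abs_mul, ← add_mul]
    refine mul_le_mul_of_nonneg_right ?_ (abs_nonneg _)
    rw [abs_mul]
    nlinarith [sq_nonneg (|z i| - |z j|), sq_abs (z i), sq_abs (z j)]
  have hrow : ∑ i, ∑ j ∈ Finset.univ.erase i, (z i ^ 2 / 2) * |h (s i - s j)| ≤
      ∑ i, (z i ^ 2 / 2) * B := by
    refine Finset.sum_le_sum fun i _ => ?_
    rw [← Finset.mul_sum]
    exact mul_le_mul_of_nonneg_left (hs.sum_abs_le hc hC hh i) (by positivity)
  have hcol : ∑ i, ∑ j ∈ Finset.univ.erase i, (z j ^ 2 / 2) * |h (s i - s j)| ≤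
      ∑ i, (z i ^ 2 / 2) * B := by
    have hh' : ∀ t, t ≠ 0 → |(fun t => h (-t)) t| ≤ C * ‖t‖⁻¹ ^ (d + 1) := by
      intro t ht
      simpa using hh (-t) (neg_ne_zero.2 ht)
    -- The column sums are the row sums of the reflected kernel `h (-t)`, which has the same decay.
    rw [Finset.sum_comm' (t' := Finset.univ) (s' := fun j => Finset.univ.erase j)
      (by intro x y; simp [eq_comm])]
    refine Finset.sum_le_sum fun j _ => ?_
    rw [← Finset.mul_sum]
    refine mul_le_mul_of_nonneg_left ?_ (by positivity)
    have := hs.sum_abs_le hc hC hh' j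
    simp only [neg_sub] at this
    exact this
  calc |∑ i, ∑ j ∈ Finset.univ.erase i, z i * z j * h (s i - s j)|
      ≤ ∑ i, ∑ j ∈ Finset.univ.erase i, |z i * z j * h (s i - s j)| :=
        (Finset.abs_sum_le_sum_abs _ _).trans
          (Finset.sum_le_sum fun i _ => Finset.abs_sum_le_sum_abs _ _)
    _ ≤ ∑ i, ∑ j ∈ Finset.univ.erase i,
          ((z i ^ 2 / 2) * |h (s i - s j)| + (z j ^ 2 / 2) * |h (s i - s j)|) :=
        Finset.sum_le_sum fun i _ => Finset.sum_le_sum fun j _ => h2 i j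
    _ ≤ ∑ i, (z i ^ 2 / 2) * B + ∑ i, (z i ^ 2 / 2) * B := by
        simp only [Finset.sum_add_distrib]
        exact add_le_add hrow hcol
    _ = B * ∑ i, z i ^ 2 := by
        rw [← Finset.sum_add_distrib, Finset.mul_sum]
        exact Finset.sum_congr rfl fun i _ => by ring

lemma sum_sum_eq_diag_add_offdiag (h : EuclideanSpace ℝ (Fin d) → ℝ) (z : Fin n → ℝ) :
    ∑ i, ∑ j, z i * z j * h (s i - s j) =
      h 0 * ∑ i, z i ^ 2 + ∑ i, ∑ j ∈ Finset.univ.erase i, z i * z j * h (s i - s j) := by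
  rw [Finset.mul_sum, ← Finset.sum_add_distrib]
  refine Finset.sum_congr rfl fun i _ => ?_
  rw [← Finset.add_sum_erase _ _ (Finset.mem_univ i), sub_self]
  ring

end Lattice

/-! ### Coercivity of trigonometric sums at separated points -/

section Trig

variable {d n : ℕ}

/-- The sum is the squared modulus of the trigonometric sum with coefficients `z i` and phases `f ·
s i`. -/
lemma trig_form_nonneg (s : Fin n → EuclideanSpace ℝ (Fin d)) (z : Fin n → ℝ)
    (f : EuclideanSpace ℝ (Fin d)) :
    0 ≤ ∑ i, ∑ j, z i * z j * Real.cos (inner ℝ f (s i - s j)) := by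
  have : ∑ i, ∑ j, z i * z j * Real.cos (inner ℝ f (s i - s j)) =
      (∑ i, z i * Real.cos (inner ℝ f (s i))) ^ 2 +
        (∑ i, z i * Real.sin (inner ℝ f (s i))) ^ 2 := by
    rw [sq, sq, Finset.sum_mul_sum, Finset.sum_mul_sum, ← Finset.sum_add_distrib]
    refine Finset.sum_congr rfl fun i _ => ?_
    rw [← Finset.sum_add_distrib]
    refine Finset.sum_congr rfl fun j _ => ?_
    rw [inner_sub_right, Real.cos_sub]
    ring
  rw [this]
  positivity

lemma integrable_mul_cos {g : EuclideanSpace ℝ (Fin d) → ℝ} (hg : Integrable g)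
    (t : EuclideanSpace ℝ (Fin d)) : Integrable fun f => g f * Real.cos (inner ℝ f t) := by
  refine hg.mul_bdd (c := 1) ?_ ?_
  · exact (by fun_prop : Continuous fun f : EuclideanSpace ℝ (Fin d) =>
      Real.cos (inner ℝ f t)).aestronglyMeasurable
  · exact Eventually.of_forall fun f => Real.abs_cos_le_one _

lemma integral_trig_form {g : EuclideanSpace ℝ (Fin d) → ℝ} (hg : Integrable g)
    (s : Fin n → EuclideanSpace ℝ (Fin d)) (z : Fin n → ℝ) :
    ∑ i, ∑ j, z i * z j * ∫ f, g f * Real.cos (inner ℝ f (s i - s j)) =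
      ∫ f, g f * ∑ i, ∑ j, z i * z j * Real.cos (inner ℝ f (s i - s j)) := by
  have hi : ∀ i j, Integrable fun f => z i * z j * (g f * Real.cos (inner ℝ f (s i - s j))) :=
    fun i j => (integrable_mul_cos hg _).const_mul _
  have e : (fun f => g f * ∑ i, ∑ j, z i * z j * Real.cos (inner ℝ f (s i - s j))) =
      fun f => ∑ i, ∑ j, z i * z j * (g f * Real.cos (inner ℝ f (s i - s j))) := by
    ext f
    rw [Finset.mul_sum]
    refine Finset.sum_congr rfl fun i _ => ?_
    rw [Finset.mul_sum]
    refine Finset.sum_congr rfl fun j _ => by ring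
  rw [e, integral_finsetSum _ fun i _ => integrable_finsetSum _ fun j _ => hi i j]
  refine Finset.sum_congr rfl fun i _ => ?_
  rw [integral_finsetSum _ fun j _ => hi i j]
  refine Finset.sum_congr rfl fun j _ => ?_
  rw [integral_const_mul]

lemma integrable_mul_trig_form {g : EuclideanSpace ℝ (Fin d) → ℝ} (hg : Integrable g)
    (s : Fin n → EuclideanSpace ℝ (Fin d)) (z : Fin n → ℝ) :
    Integrable fun f => g f * ∑ i, ∑ j, z i * z j * Real.cos (inner ℝ f (s i - s j)) := by
  have e : (fun f => g f * ∑ i, ∑ j, z i * z j * Real.cos (inner ℝ f (s i - s j))) =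
      fun f => ∑ i, ∑ j, z i * z j * (g f * Real.cos (inner ℝ f (s i - s j))) := by
    ext f
    rw [Finset.mul_sum]
    refine Finset.sum_congr rfl fun i _ => ?_
    rw [Finset.mul_sum]
    refine Finset.sum_congr rfl fun j _ => by ring
  rw [e]
  exact integrable_finsetSum _ fun i _ => integrable_finsetSum _ fun j _ =>
    (integrable_mul_cos hg _).const_mul _

lemma re_fourier_ofReal {g : EuclideanSpace ℝ (Fin d) → ℝ} (hg : Integrable g)
    (w : EuclideanSpace ℝ (Fin d)) :
    (FourierTransform.fourier (fun f => ((g f : ℝ) : ℂ)) w).re =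
      ∫ f, g f * Real.cos (2 * Real.pi * inner ℝ f w) := by
  rw [Real.fourier_eq']
  have hint : Integrable fun f : EuclideanSpace ℝ (Fin d) =>
      Complex.exp (((-2 * Real.pi * inner ℝ f w : ℝ) : ℂ) * Complex.I) • ((g f : ℝ) : ℂ) := by
    refine hg.ofReal.bdd_mul (c := 1) ?_ ?_
    · exact (by fun_prop : Continuous fun f : EuclideanSpace ℝ (Fin d) =>
        Complex.exp (((-2 * Real.pi * inner ℝ f w : ℝ) : ℂ) * Complex.I)).aestronglyMeasurable
    · exact Eventually.of_forall fun f => (Complex.norm_exp_ofReal_mul_I _).le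
  refine (integral_re hint).symm.trans ?_
  refine integral_congr_ae (Eventually.of_forall fun f => ?_)
  change (_ * ((g f : ℝ) : ℂ)).re = _
  rw [Complex.re_mul_ofReal, Complex.exp_ofReal_mul_I_re, mul_comm, neg_mul, neg_mul,
    Real.cos_neg]

/-- A cutoff function whose cosine transform decays like `‖t‖^{-(d+1)}`. -/
lemma exists_cutoff (d : ℕ) : ∃ (ψ : EuclideanSpace ℝ (Fin d) → ℝ) (C : ℝ), 0 < C ∧
    Continuous ψ ∧ Integrable ψ ∧ (∀ f, 0 ≤ ψ f ∧ ψ f ≤ 1) ∧ (∀ f, 2 < ‖f‖ → ψ f = 0) ∧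
    0 < ∫ f, ψ f ∧
    ∀ t, t ≠ 0 → |∫ f, ψ f * Real.cos (inner ℝ f t)| ≤ C * ‖t‖⁻¹ ^ (d + 1) := by
  let b : ContDiffBump (0 : EuclideanSpace ℝ (Fin d)) := ⟨1, 2, one_pos, one_lt_two⟩
  have hcs : HasCompactSupport fun f => ((b f : ℝ) : ℂ) :=
    b.hasCompactSupport.comp_left (g := fun x : ℝ => (x : ℂ)) Complex.ofReal_zero
  have hsm : ContDiff ℝ (⊤ : ℕ∞) fun f => ((b f : ℝ) : ℂ) :=
    Complex.ofRealCLM.contDiff.comp b.contDiff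
  let Ψ : SchwartzMap (EuclideanSpace ℝ (Fin d)) ℂ := hcs.toSchwartzMap hsm
  -- The Fourier transform of a smooth bump is a Schwartz function; `w = t / 2π` below adjusts the
  -- normalization.
  obtain ⟨C, hC, hdec⟩ := (FourierTransform.fourier Ψ).decay (d + 1) 0
  refine ⟨b, (2 * Real.pi) ^ (d + 1) * C, by positivity, b.continuous,
    b.continuous.integrable_of_hasCompactSupport b.hasCompactSupport,
    fun f => ⟨b.nonneg, b.le_one⟩, ?_, b.integral_pos, ?_⟩
  · intro f hf
    exact b.zero_of_le_dist (by simpa using hf.le)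
  · intro t ht
    have hπ : (0 : ℝ) < 2 * Real.pi := by positivity
    set w : EuclideanSpace ℝ (Fin d) := (2 * Real.pi)⁻¹ • t with hw
    have hre : (FourierTransform.fourier Ψ w).re = ∫ f, b f * Real.cos (inner ℝ f t) := by
      have hbi : Integrable b := b.continuous.integrable_of_hasCompactSupport b.hasCompactSupport
      rw [SchwartzMap.fourier_coe]
      refine (re_fourier_ofReal hbi w).trans ?_
      refine integral_congr_ae (Eventually.of_forall fun f => ?_)
      have h1 : 2 * Real.pi * inner ℝ f w = inner ℝ f t := by
        rw [hw, inner_smul_right]; field_simp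
      simp only [h1]
    have hb := hdec w
    rw [norm_iteratedFDeriv_zero] at hb
    have hnw : ‖w‖ = (2 * Real.pi)⁻¹ * ‖t‖ := by
      rw [hw, norm_smul, Real.norm_of_nonneg (by positivity)]
    have htp : 0 < ‖t‖ := norm_pos_iff.2 ht
    rw [← hre]
    refine (Complex.abs_re_le_norm _).trans ?_
    rw [hnw, mul_pow, inv_pow] at hb
    rw [inv_pow, ← div_eq_mul_inv, le_div_iff₀ (by positivity)]
    calc ‖FourierTransform.fourier Ψ w‖ * ‖t‖ ^ (d + 1)
        = (2 * Real.pi) ^ (d + 1) * ((((2 * Real.pi) ^ (d + 1))⁻¹ * ‖t‖ ^ (d + 1)) *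
            ‖FourierTransform.fourier Ψ w‖) := by
          field_simp
      _ ≤ (2 * Real.pi) ^ (d + 1) * C := by gcongr

/-- For separated points, trigonometric sums are bounded below in mean square over a large
ball. -/
lemma exists_trig_lower_bound (d : ℕ) {c : ℝ} (hc : 0 < c) :
    ∃ (χ : EuclideanSpace ℝ (Fin d) → ℝ) (M a : ℝ), 0 < a ∧ Integrable χ ∧
      (∀ f, 0 ≤ χ f ∧ χ f ≤ 1) ∧ (∀ f, M < ‖f‖ → χ f = 0) ∧
      ∀ (n : ℕ) (s : Fin n → EuclideanSpace ℝ (Fin d)), IsLatticeSeparated c s →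
        ∀ z : Fin n → ℝ, a * ∑ i, z i ^ 2 ≤
          ∫ f, χ f * ∑ i, ∑ j, z i * z j * Real.cos (inner ℝ f (s i - s j)) := by
  obtain ⟨ψ, C, hC, hψc, hψi, hψ01, hψ0, hpos, hdec⟩ := exists_cutoff d
  set I₀ := ∫ f, ψ f with hI₀
  set S := c⁻¹ ^ (d + 1) * latticeSum d with hS
  have hS0 : 0 ≤ S := mul_nonneg (by positivity) (latticeSum_nonneg d)
  -- The cosine transform of `ψ (f / M)` equals `M ^ d * I₀` at `0` and decays with constant `C /
  -- M`. This `M` makes the off-diagonal part at most half of the diagonal one, which leaves `a = M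
  -- ^ d * I₀ / 2`.
  set M : ℝ := max 1 (2 * C * S / I₀) with hM
  have hM1 : 1 ≤ M := le_max_left _ _
  have hM0 : 0 < M := by linarith
  have hM2 : 2 * C * S ≤ M * I₀ := by
    rw [← div_le_iff₀ hpos]; exact le_max_right _ _
  have hcomp : ∀ t, ∫ f, ψ (M⁻¹ • f) * Real.cos (inner ℝ f t) =
      M ^ d * ∫ f, ψ f * Real.cos (inner ℝ f (M • t)) := by
    intro t
    have h := Measure.integral_comp_inv_smul volume
      (fun f : EuclideanSpace ℝ (Fin d) => ψ f * Real.cos (inner ℝ f (M • t))) M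
    have e : ∀ f : EuclideanSpace ℝ (Fin d), inner ℝ (M⁻¹ • f) (M • t) = inner ℝ f t := by
      intro f
      rw [inner_smul_left, inner_smul_right]
      simp
      field_simp
    simp only [e, finrank_euclideanSpace_fin, smul_eq_mul] at h
    rw [h, abs_of_nonneg (by positivity)]
  have hχi : Integrable fun f => ψ (M⁻¹ • f) := hψi.comp_smul (inv_ne_zero hM0.ne')
  refine ⟨fun f => ψ (M⁻¹ • f), 2 * M, M ^ d * I₀ / 2, by positivity, hχi,
    fun f => hψ01 _, ?_, ?_⟩
  · intro f hf
    refine hψ0 _ ?_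
    rw [norm_smul, norm_inv, Real.norm_of_nonneg hM0.le, lt_inv_mul_iff₀ hM0]
    linarith
  · intro n s hs z
    set H : EuclideanSpace ℝ (Fin d) → ℝ := fun t => ∫ f, ψ (M⁻¹ • f) * Real.cos (inner ℝ f t)
      with hH
    rw [← integral_trig_form hχi]
    change _ ≤ ∑ i, ∑ j, z i * z j * H (s i - s j)
    have hHd : ∀ t, t ≠ 0 → |H t| ≤ (C / M) * ‖t‖⁻¹ ^ (d + 1) := by
      intro t ht
      rw [hH]
      simp only [hcomp]
      rw [abs_mul, abs_of_nonneg (by positivity : (0:ℝ) ≤ M ^ d)]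
      have h1 := hdec (M • t) (smul_ne_zero hM0.ne' ht)
      refine (mul_le_mul_of_nonneg_left h1 (by positivity)).trans (le_of_eq ?_)
      rw [norm_smul, Real.norm_of_nonneg hM0.le, mul_inv, mul_pow]
      have h2 : M ^ d * M⁻¹ ^ (d + 1) = M⁻¹ := by
        rw [pow_succ, ← mul_assoc, ← mul_pow, mul_inv_cancel₀ hM0.ne', one_pow, one_mul]
      calc M ^ d * (C * (M⁻¹ ^ (d + 1) * ‖t‖⁻¹ ^ (d + 1)))
          = (M ^ d * M⁻¹ ^ (d + 1)) * C * ‖t‖⁻¹ ^ (d + 1) := by ring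
        _ = _ := by rw [h2]; ring
    have hH0 : H 0 = M ^ d * I₀ := by
      rw [hH]
      simp only [hcomp]
      simp [hI₀]
    rw [sum_sum_eq_diag_add_offdiag H, hH0]
    have hoff := hs.abs_offdiag_le hc (by positivity) hHd z
    have hzz : 0 ≤ ∑ i, z i ^ 2 := Finset.sum_nonneg fun _ _ => sq_nonneg _
    have hB : C / M * c⁻¹ ^ (d + 1) * latticeSum d ≤ M ^ d * I₀ / 2 := by
      rw [mul_assoc, ← hS]
      have h1 : C / M * S ≤ I₀ / 2 := by
        rw [div_mul_eq_mul_div, div_le_iff₀ hM0]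
        linarith
      have h2 : 1 ≤ M ^ d := one_le_pow₀ hM1
      nlinarith
    have := (abs_le.1 hoff).1
    nlinarith [mul_le_mul_of_nonneg_right hB hzz]

end Trig

/-! ### Uniform spectral bounds for the parametric family -/

section Model

variable {d p : ℕ} {θinf θsup : ℝ} {K : (Fin p → ℝ) → EuclideanSpace ℝ (Fin d) → ℝ}

lemma RegularModel.exists_bound (hK : RegularModel θinf θsup K) :
    ∃ C : ℝ, 0 < C ∧ ∀ θ ∈ paramSet p θinf θsup, ∀ t, |K θ t| ≤ C / (1 + ‖t‖ ^ (d + 1)) := by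
  obtain ⟨C, hC⟩ := hK.bound [] (by simp)
  refine ⟨max C 1, by positivity, fun θ hθ t => (hC θ hθ t).trans ?_⟩
  gcongr
  exact le_max_left _ _

lemma RegularModel.eq_integral_cos (hK : RegularModel θinf θsup K) {θ : Fin p → ℝ}
    (hθ : θ ∈ paramSet p θinf θsup) (t : EuclideanSpace ℝ (Fin d)) :
    K θ t = ∫ f, (fourierHat (K θ) f).re * Real.cos (inner ℝ f t) := by
  have h := hK.inversion θ hθ t
  have hint : Integrable fun f : EuclideanSpace ℝ (Fin d) =>
      fourierHat (K θ) f * Complex.exp (Complex.I * ((inner ℝ f t : ℝ) : ℂ)) := by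
    refine (hK.integrable_hat θ hθ).mul_bdd (c := 1) ?_ ?_
    · exact (by fun_prop : Continuous fun f : EuclideanSpace ℝ (Fin d) =>
        Complex.exp (Complex.I * ((inner ℝ f t : ℝ) : ℂ))).aestronglyMeasurable
    · refine Eventually.of_forall fun f => ?_
      rw [mul_comm, Complex.norm_exp_ofReal_mul_I]
  have h2 := congrArg Complex.re h
  rw [Complex.ofReal_re] at h2
  rw [h2]
  refine (integral_re hint).symm.trans ?_
  refine integral_congr_ae (Eventually.of_forall fun f => ?_)
  change (_ : ℂ).re = _
  rw [Complex.mul_re, (hK.pos_hat θ hθ f).1, zero_mul, sub_zero, mul_comm Complex.I,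
    Complex.exp_ofReal_mul_I_re]

lemma RegularModel.integrable_re_hat (hK : RegularModel θinf θsup K) {θ : Fin p → ℝ}
    (hθ : θ ∈ paramSet p θinf θsup) : Integrable fun f => (fourierHat (K θ) f).re :=
  (hK.integrable_hat θ hθ).re

lemma RegularModel.continuous (hK : RegularModel θinf θsup K) {θ : Fin p → ℝ}
    (hθ : θ ∈ paramSet p θinf θsup) : Continuous (K θ) := by
  have e : K θ = fun t => ∫ f, (fourierHat (K θ) f).re * Real.cos (inner ℝ f t) :=
    funext fun t => hK.eq_integral_cos hθ t
  rw [e]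
  refine continuous_of_dominated (bound := fun f => ‖(fourierHat (K θ) f).re‖) ?_ ?_ ?_ ?_
  · exact fun t => (integrable_mul_cos (hK.integrable_re_hat hθ) t).aestronglyMeasurable
  · intro t
    refine Eventually.of_forall fun f => ?_
    rw [norm_mul]
    exact mul_le_of_le_one_right (norm_nonneg _) (Real.abs_cos_le_one _)
  · exact (hK.integrable_re_hat hθ).norm
  · exact Eventually.of_forall fun f => by fun_prop

/-- The covariance matrices of separated points are uniformly bounded and uniformly positive
definite. -/
theorem RegularModel.exists_spectralBounds (hK : RegularModel θinf θsup K)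
    {c : ℝ} (hc : 0 < c) :
    ∃ l u : ℝ, 0 < l ∧ 0 < u ∧ ∀ θ ∈ paramSet p θinf θsup, ∀ (n : ℕ)
      (s : Fin n → EuclideanSpace ℝ (Fin d)), IsLatticeSeparated c s →
        SpectralBounds l u (covMatrix (K θ) s) := by
  obtain ⟨C, hC, hKC⟩ := hK.exists_bound
  obtain ⟨χ, M, a, ha, hχi, hχ01, hχ0, hlow⟩ := exists_trig_lower_bound d hc
  have hcomp : IsCompact (Metric.closedBall (0 : EuclideanSpace ℝ (Fin d)) M ×ˢ
      paramSet p θinf θsup) := (isCompact_closedBall _ _).prod isCompact_Icc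
  have hcont : ContinuousOn (fun q : EuclideanSpace ℝ (Fin d) × (Fin p → ℝ) =>
      (fourierHat (K q.2) q.1).re) (Metric.closedBall 0 M ×ˢ paramSet p θinf θsup) :=
    Complex.continuous_re.comp_continuousOn
      (hK.continuous_hat.mono (Set.prod_mono (Set.subset_univ _) subset_rfl))
  -- A positive lower bound of the spectral density on the support of the cutoff, uniform in `θ` by
  -- compactness.
  obtain ⟨m, hm, hmin⟩ := hcomp.exists_forall_le' hcont (a := 0)
    fun q hq => (hK.pos_hat q.2 hq.2 q.1).2
  have hquad : ∀ θ (n : ℕ) (s : Fin n → EuclideanSpace ℝ (Fin d)) (z : Fin n → ℝ),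
      z ⬝ᵥ (Matrix.mulVec (covMatrix (K θ) s) z) = ∑ i, ∑ j, z i * z j * K θ (s i - s j) := by
    intro θ n s z
    simp only [dotProduct, Matrix.mulVec, covMatrix, Matrix.of_apply, Finset.mul_sum]
    exact Finset.sum_congr rfl fun i _ => Finset.sum_congr rfl fun j _ => by ring
  have hdot : ∀ (n : ℕ) (z : Fin n → ℝ), z ⬝ᵥ z = ∑ i, z i ^ 2 := by
    intro n z; simp [dotProduct, sq]
  have hS := latticeSum_nonneg d
  refine ⟨m * a, C + C * c⁻¹ ^ (d + 1) * latticeSum d, by positivity, by positivity,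
    fun θ hθ n s hs => ⟨?_, fun z => ?_, fun z => ?_⟩⟩
  · have := (hK.stationary θ hθ n s).1
    rwa [Matrix.IsHermitian, Matrix.conjTranspose_eq_transpose_of_trivial] at this
  · rw [hquad, hdot]
    have hi := hK.integrable_re_hat hθ
    have e : ∑ i, ∑ j, z i * z j * K θ (s i - s j) = ∑ i, ∑ j, z i * z j *
        ∫ f, (fourierHat (K θ) f).re * Real.cos (inner ℝ f (s i - s j)) :=
      Finset.sum_congr rfl fun i _ => Finset.sum_congr rfl fun j _ => by
        rw [← hK.eq_integral_cos hθ]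
    rw [e, integral_trig_form hi, mul_assoc]
    refine (mul_le_mul_of_nonneg_left (hlow n s hs z) hm.le).trans ?_
    rw [← integral_const_mul]
    -- The spectral density dominates `m * χ` everywhere, and the trigonometric form is nonnegative.
    refine integral_mono ((integrable_mul_trig_form hχi s z).const_mul m)
      (integrable_mul_trig_form hi s z) fun f => ?_
    simp only
    rw [← mul_assoc]
    refine mul_le_mul_of_nonneg_right ?_ (trig_form_nonneg s z f)
    by_cases hf : M < ‖f‖
    · rw [hχ0 f hf, mul_zero]
      exact (hK.pos_hat θ hθ f).2.le
    · have h1 := hmin (f, θ) ⟨by simpa using not_lt.1 hf, hθ⟩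
      have h2 := (hχ01 f).2
      simp only at h1
      nlinarith
  · rw [hquad, hdot, sum_sum_eq_diag_add_offdiag, add_mul]
    have hzz : 0 ≤ ∑ i, z i ^ 2 := Finset.sum_nonneg fun _ _ => sq_nonneg _
    have h0 : K θ 0 ≤ C := by
      have := (le_abs_self _).trans (hKC θ hθ 0)
      simpa using this
    refine add_le_add (mul_le_mul_of_nonneg_right h0 hzz) ?_
    refine (le_abs_self _).trans (hs.abs_offdiag_le hc hC.le ?_ z)
    intro t ht
    have htp : 0 < ‖t‖ := norm_pos_iff.2 ht
    refine (hKC θ hθ t).trans ?_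
    rw [inv_pow, ← div_eq_mul_inv]
    gcongr
    linarith

end Model

/-! ### Averages over the enumerated grid -/

section Grid

variable {d : ℕ} {v : ℕ → Fin d → ℤ}

lemma card_intCube (a b : ℤ) : (Fintype.piFinset fun _ : Fin d => Finset.Icc a b).card =
    (b + 1 - a).toNat ^ d := by
  simp [Fintype.card_piFinset]

lemma IsGridEnumeration.image_eq (hv : IsGridEnumeration v) {N : ℕ} (hN : 1 ≤ N) :
    (Finset.range (N ^ d)).image v = Fintype.piFinset fun _ => Finset.Icc 1 (N : ℤ) := by
  ext u
  have h := Set.ext_iff.1 (hv N hN) u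
  simpa [Fintype.mem_piFinset] using h

/-- The first `N ^ d` indices map onto a set of `N ^ d` points, hence injectively. -/
lemma IsGridEnumeration.injective (hv : IsGridEnumeration v) (hd : 0 < d) :
    Function.Injective v := by
  intro i j hij
  set N := max i j + 1 with hN
  have hle : N ≤ N ^ d := Nat.le_self_pow hd.ne' N
  have hcard : ((Finset.range (N ^ d)).image v).card = (Finset.range (N ^ d)).card := by
    rw [hv.image_eq (by omega), card_intCube, Finset.card_range]
    simp
  have hinj := Finset.card_image_iff.1 hcard
  refine hinj ?_ ?_ hij
  · simp only [Finset.coe_range, Set.mem_Iio]; omega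
  · simp only [Finset.coe_range, Set.mem_Iio]; omega

lemma sum_sum_le_tsum (hinj : Function.Injective v) (G : (Fin d → ℤ) → ℝ≥0∞) (n : ℕ) :
    ∑ i ∈ Finset.range n, ∑ j ∈ Finset.range n, G (v i - v j) ≤ n * ∑' w, G w := by
  have h : ∀ i ∈ Finset.range n, ∑ j ∈ Finset.range n, G (v i - v j) ≤ ∑' w, G w := by
    intro i _
    have hi : Set.InjOn (fun j => v i - v j) (Finset.range n) :=
      fun a _ b _ hab => hinj (sub_right_injective hab)
    rw [← Finset.sum_image hi]
    exact ENNReal.sum_le_tsum _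
  refine (Finset.sum_le_card_nsmul _ _ _ h).trans ?_
  simp

lemma exists_pow_le_lt (hd : 0 < d) {N₀ n : ℕ} (h : N₀ ^ d ≤ n) :
    ∃ N, N₀ ≤ N ∧ N ^ d ≤ n ∧ n < (N + 1) ^ d := by
  have hex : ∃ m, n < (m + 1) ^ d :=
    ⟨n, (Nat.lt_succ_self n).trans_le (Nat.le_self_pow hd.ne' _)⟩
  classical
  refine ⟨Nat.find hex, ?_, ?_, Nat.find_spec hex⟩
  · by_contra hlt
    have h1 : (Nat.find hex + 1) ^ d ≤ N₀ ^ d := Nat.pow_le_pow_left (by omega) d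
    have := Nat.find_spec hex
    omega
  · rcases Nat.eq_zero_or_pos (Nat.find hex) with h0 | h0
    · rw [h0, zero_pow hd.ne']; omega
    · have := Nat.find_min hex (m := Nat.find hex - 1) (by omega)
      rw [Nat.sub_add_cancel h0] at this
      omega

/-- With `N ^ d ≤ n < (N + 1) ^ d`, the first `n` points contain the cube of side `N`. If `M` bounds
the coordinates of `F`, each point at depth `M` in that cube sees all of `F` among its differences.
There are `(N - 2 M) ^ d` such points, and `N ≥ 4 M + 1` gives `N + 1 ≤ 2 (N - 2 M)`, whence the
factor `2 ^ d`. -/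
lemma IsGridEnumeration.le_sum_sum (hv : IsGridEnumeration v) (hd : 0 < d)
    (G : (Fin d → ℤ) → ℝ≥0∞) (F : Finset (Fin d → ℤ)) :
    ∃ n₀ : ℕ, ∀ n, n₀ ≤ n → n * ∑ w ∈ F, G w ≤
      2 ^ d * ∑ i ∈ Finset.range n, ∑ j ∈ Finset.range n, G (v i - v j) := by
  classical
  obtain ⟨M, hM⟩ : ∃ M : ℕ, ∀ w ∈ F, ∀ k, |w k| ≤ M := by
    refine ⟨F.sup fun w => Finset.univ.sup fun k => (w k).natAbs, fun w hw k => ?_⟩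
    have h1 : (w k).natAbs ≤ F.sup fun w => Finset.univ.sup fun k => (w k).natAbs :=
      (Finset.le_sup (f := fun k => (w k).natAbs) (Finset.mem_univ k)).trans
        (Finset.le_sup (f := fun w : Fin d → ℤ => Finset.univ.sup fun k => (w k).natAbs) hw)
    rw [Int.abs_eq_natAbs]
    exact_mod_cast h1
  refine ⟨(4 * M + 1) ^ d, fun n hn => ?_⟩
  obtain ⟨N, hN₀, hNn, hnN⟩ := exists_pow_le_lt hd hn
  have hinj := hv.injective hd
  have hcube := hv.image_eq (N := N) (by omega)
  have hmem : ∀ u : Fin d → ℤ, (∀ k, 1 ≤ u k ∧ u k ≤ N) → ∃ j ∈ Finset.range n, v j = u := by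
    intro u hu
    have : u ∈ (Finset.range (N ^ d)).image v := by
      rw [hcube]; simpa [Fintype.mem_piFinset] using hu
    obtain ⟨j, hj, rfl⟩ := Finset.mem_image.1 this
    exact ⟨j, Finset.mem_range.2 ((Finset.mem_range.1 hj).trans_le hNn), rfl⟩
  set Q : Finset (Fin d → ℤ) :=
    Fintype.piFinset fun _ => Finset.Icc (1 + M : ℤ) (N - M) with hQ
  set T := (Finset.range n).filter fun i => v i ∈ Q with hT
  have hrow : ∀ i ∈ T, ∑ w ∈ F, G w ≤ ∑ j ∈ Finset.range n, G (v i - v j) := by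
    intro i hi
    have hiQ := (Finset.mem_filter.1 hi).2
    rw [hQ, Fintype.mem_piFinset] at hiQ
    have hio : Set.InjOn (fun j => v i - v j) (Finset.range n) :=
      fun a _ b _ hab => hinj (sub_right_injective hab)
    rw [← Finset.sum_image hio]
    refine Finset.sum_le_sum_of_subset fun w hw => ?_
    obtain ⟨j, hj, hjw⟩ := hmem (v i - w) fun k => by
      have h1 := Finset.mem_Icc.1 (hiQ k)
      have h2 := abs_le.1 (hM w hw k)
      simp only [Pi.sub_apply]
      constructor <;> linarith [h1.1, h1.2, h2.1, h2.2]
    refine Finset.mem_image.2 ⟨j, hj, ?_⟩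
    simp only [hjw, sub_sub_cancel]
  have hTcard : Q.card ≤ T.card := by
    have hsub : Q ⊆ T.image v := by
      intro u hu
      have huQ := hu
      rw [hQ, Fintype.mem_piFinset] at huQ
      obtain ⟨j, hj, rfl⟩ := hmem u fun k => by
        have h1 := Finset.mem_Icc.1 (huQ k)
        constructor <;> linarith [h1.1, h1.2, (Int.natCast_nonneg M)]
      exact Finset.mem_image.2 ⟨j, Finset.mem_filter.2 ⟨hj, hu⟩, rfl⟩
    exact (Finset.card_le_card hsub).trans Finset.card_image_le
  have hnT : n ≤ 2 ^ d * T.card := by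
    refine le_trans ?_ (Nat.mul_le_mul_left _ hTcard)
    rw [hQ, card_intCube, ← mul_pow]
    refine hnN.le.trans (Nat.pow_le_pow_left ?_ d)
    omega
  have hnT' : (n : ℝ≥0∞) ≤ 2 ^ d * (T.card : ℝ≥0∞) := by exact_mod_cast hnT
  calc (n : ℝ≥0∞) * ∑ w ∈ F, G w ≤ 2 ^ d * T.card * ∑ w ∈ F, G w := by gcongr
    _ = 2 ^ d * ∑ _i ∈ T, ∑ w ∈ F, G w := by
        rw [Finset.sum_const, nsmul_eq_mul, mul_assoc]
    _ ≤ 2 ^ d * ∑ i ∈ T, ∑ j ∈ Finset.range n, G (v i - v j) := by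
        gcongr with i hi
        exact hrow i hi
    _ ≤ _ := by
        gcongr
        exact Finset.filter_subset _ _

end Grid

/-! ### Separation of the perturbed grid -/

section Separation

variable {d : ℕ} {v : ℕ → Fin d → ℤ} {ε : ℝ}

/-- At a coordinate where `|w k|` is maximal, the perturbation is at most `2 ε ≤ 2 ε |w k|`, because
`w k` is a nonzero integer. -/
lemma norm_latticePoint_add_ge {ε : ℝ} (hε : 0 ≤ ε) {x y : EuclideanSpace ℝ (Fin d)}
    (hx : ∀ k, -1 ≤ x k ∧ x k ≤ 1) (hy : ∀ k, -1 ≤ y k ∧ y k ≤ 1) {w : Fin d → ℤ} (hw : w ≠ 0) :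
    (1 - 2 * ε) * ‖w‖ ≤ ‖latticePoint w + ε • (x - y)‖ := by
  obtain ⟨k₀, _⟩ := Function.ne_iff.1 hw
  have : Nonempty (Fin d) := ⟨k₀⟩
  obtain ⟨k, hk⟩ := Finite.exists_max fun k => ‖w k‖
  have hwk : ‖w‖ = ‖w k‖ :=
    le_antisymm ((pi_norm_le_iff_of_nonneg (norm_nonneg _)).2 hk) (norm_le_pi_norm w k)
  have hwk1 : 1 ≤ ‖w k‖ := by
    have h0 : w k ≠ 0 := by
      intro h0
      rw [h0, norm_zero, norm_eq_zero] at hwk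
      exact hw hwk
    rw [Int.norm_eq_abs]
    exact_mod_cast Int.one_le_abs h0
  have h1 : ‖(latticePoint w + ε • (x - y)) k‖ ≤ ‖latticePoint w + ε • (x - y)‖ :=
    PiLp.norm_apply_le _ k
  have h2 : (latticePoint w + ε • (x - y)) k = w k + ε * (x k - y k) := by
    simp [latticePoint]
  have h3 : |ε * (x k - y k)| ≤ 2 * ε := by
    rw [abs_mul, abs_of_nonneg hε, mul_comm 2]
    refine mul_le_mul_of_nonneg_left (abs_le.2 ?_) hε
    constructor <;> linarith [(hx k).1, (hx k).2, (hy k).1, (hy k).2]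
  have h4 : |(w k : ℝ)| - |ε * (x k - y k)| ≤ |w k + ε * (x k - y k)| := by
    have := abs_sub_abs_le_abs_sub (w k : ℝ) (-(ε * (x k - y k)))
    rwa [abs_neg, sub_neg_eq_add] at this
  rw [h2, Real.norm_eq_abs] at h1
  rw [hwk]
  rw [Int.norm_eq_abs] at hwk1 ⊢
  nlinarith

lemma latticePoint_sub (w w' : Fin d → ℤ) :
    latticePoint (w - w') = latticePoint w - latticePoint w' := by
  ext k; simp [latticePoint]

lemma obsPoint_sub (x : ℕ → EuclideanSpace ℝ (Fin d)) (i j : ℕ) :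
    obsPoint v ε x i - obsPoint v ε x j = latticePoint (v i - v j) + ε • (x i - x j) := by
  rw [obsPoint, obsPoint, latticePoint_sub, smul_sub]
  abel

lemma isLatticeSeparated_obsPoint (hinj : Function.Injective v) (hε : 0 ≤ ε)
    {x : ℕ → EuclideanSpace ℝ (Fin d)} (hx : ∀ i k, -1 ≤ x i k ∧ x i k ≤ 1) (n : ℕ) :
    IsLatticeSeparated (1 - 2 * ε) fun i : Fin n => obsPoint v ε x i := by
  refine ⟨fun i => v i, fun i j h => Fin.ext (hinj h), fun i j => ?_⟩
  rw [obsPoint_sub]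
  by_cases h : v i - v j = 0
  · rw [h, norm_zero, mul_zero]; exact norm_nonneg _
  · exact norm_latticePoint_add_ge hε (hx i) (hx j) h

end Separation

/-! ### Expected Frobenius distance of the covariance matrices -/

section Energy

variable {d : ℕ}

/-- The mean of `g (w + ε (x - y))` for independent `x`, `y` with law `μ`, set to `0` at `w = 0`. -/
noncomputable def pairEnergy (μ : Measure (EuclideanSpace ℝ (Fin d))) (ε : ℝ)
    (g : EuclideanSpace ℝ (Fin d) → ℝ) (w : Fin d → ℤ) : ℝ≥0∞ :=
  open Classical in
  if w = 0 then 0 else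
    ∫⁻ q, ENNReal.ofReal (g (latticePoint w + ε • (q.1 - q.2))) ∂(μ.prod μ)

lemma ae_mem_cube {μ : Measure (EuclideanSpace ℝ (Fin d))} (hμ : IsPerturbationLaw μ) :
    ∀ᵐ x ∂μ, ∀ k, -1 ≤ x k ∧ x k ≤ 1 := by
  filter_upwards [Measure.support_mem_ae (μ := μ)] with x hx
  exact hμ.support_subset x hx

variable {μ : Measure (EuclideanSpace ℝ (Fin d))} {ΩX : Type*} [MeasurableSpace ΩX]
  {PX : Measure ΩX} {X : ℕ → ΩX → EuclideanSpace ℝ (Fin d)}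

lemma ae_forall_mem_cube (hμ : IsPerturbationLaw μ) (hX_meas : ∀ i, Measurable (X i))
    (hX_law : ∀ i, PX.map (X i) = μ) : ∀ᵐ ω ∂PX, ∀ i k, -1 ≤ X i ω k ∧ X i ω k ≤ 1 := by
  refine ae_all_iff.2 fun i => ?_
  have h := ae_mem_cube hμ
  rw [← hX_law i] at h
  exact ae_of_ae_map (hX_meas i).aemeasurable h

/-- For `i ≠ j` the pair `(X i, X j)` has law `μ.prod μ`. The diagonal terms vanish because `k 0 =
k₀ 0`, which matches the value `0` of `pairEnergy` at the origin. -/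
lemma lintegral_frobSq [IsProbabilityMeasure PX] {v : ℕ → Fin d → ℤ} (hinj : Function.Injective v) (ε : ℝ)
    (hX_meas : ∀ i, Measurable (X i)) (hX_indep : iIndepFun X PX)
    (hX_law : ∀ i, PX.map (X i) = μ) {k k₀ : EuclideanSpace ℝ (Fin d) → ℝ}
    (hk : Continuous k) (hk₀ : Continuous k₀) (h0 : k 0 = k₀ 0) (n : ℕ) :
    ∫⁻ ω, ENNReal.ofReal (frobSq
      (covMatrix k (fun i : Fin n => obsPoint v ε (fun j => X j ω) i) -
        covMatrix k₀ (fun i : Fin n => obsPoint v ε (fun j => X j ω) i))) ∂PX =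
    ∑ i ∈ Finset.range n, ∑ j ∈ Finset.range n,
      pairEnergy μ ε (fun t => (k t - k₀ t) ^ 2) (v i - v j) := by
  set g : EuclideanSpace ℝ (Fin d) → ℝ := fun t => (k t - k₀ t) ^ 2 with hg
  have hgc : Continuous g := by fun_prop
  have e : ∀ ω, ENNReal.ofReal (frobSq
      (covMatrix k (fun i : Fin n => obsPoint v ε (fun j => X j ω) i) -
        covMatrix k₀ (fun i : Fin n => obsPoint v ε (fun j => X j ω) i))) =
      ∑ i ∈ Finset.range n, ∑ j ∈ Finset.range n,
        ENNReal.ofReal (g (latticePoint (v i - v j) + ε • (X i ω - X j ω))) := by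
    intro ω
    have e1 : frobSq (covMatrix k (fun i : Fin n => obsPoint v ε (fun j => X j ω) i) -
        covMatrix k₀ (fun i : Fin n => obsPoint v ε (fun j => X j ω) i)) =
        ∑ i ∈ Finset.range n, ∑ j ∈ Finset.range n,
          g (latticePoint (v i - v j) + ε • (X i ω - X j ω)) := by
      rw [Finset.sum_range]
      refine Finset.sum_congr rfl fun i _ => ?_
      rw [Finset.sum_range]
      refine Finset.sum_congr rfl fun j _ => ?_
      simp only [Matrix.sub_apply, covMatrix, Matrix.of_apply, obsPoint_sub, hg]
    rw [e1, ENNReal.ofReal_sum_of_nonneg fun _ _ => Finset.sum_nonneg fun _ _ => sq_nonneg _]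
    exact Finset.sum_congr rfl fun i _ => ENNReal.ofReal_sum_of_nonneg fun _ _ => sq_nonneg _
  simp only [e]
  have hm : ∀ i j, Measurable fun ω =>
      ENNReal.ofReal (g (latticePoint (v i - v j) + ε • (X i ω - X j ω))) := by
    intro i j
    have h1 := hX_meas i
    have h2 := hX_meas j
    have h3 := hgc.measurable
    fun_prop
  rw [lintegral_finsetSum _ fun i _ => Finset.measurable_fun_sum _ fun j _ => hm i j]
  refine Finset.sum_congr rfl fun i _ => ?_
  rw [lintegral_finsetSum _ fun j _ => hm i j]
  refine Finset.sum_congr rfl fun j _ => ?_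
  unfold pairEnergy
  by_cases hij : v i - v j = 0
  · rw [if_pos hij]
    have : i = j := hinj (sub_eq_zero.1 hij)
    subst this
    have hz : latticePoint (0 : Fin d → ℤ) = 0 := by ext k; simp [latticePoint]
    simp [hz, hg, h0]
  · rw [if_neg hij]
    have hne : i ≠ j := fun h => hij (by rw [h, sub_self])
    have hlaw : PX.map (fun ω => (X i ω, X j ω)) = μ.prod μ := by
      rw [(indepFun_iff_map_prod_eq_prod_map_map (hX_meas i).aemeasurable
        (hX_meas j).aemeasurable).1 (hX_indep.indepFun hne), hX_law, hX_law]
    rw [← hlaw, lintegral_map _ ((hX_meas i).prodMk (hX_meas j))]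
    have h3 := hgc.measurable
    fun_prop

end Energy

/-! ### The excess error compared with pair energies, at fixed `n` and in the limit -/

section Excess

variable {d p : ℕ} {θinf θsup : ℝ} {K : (Fin p → ℝ) → EuclideanSpace ℝ (Fin d) → ℝ}
  {θ₀ : Fin p → ℝ} {v : ℕ → Fin d → ℤ} {ε : ℝ} {μ : Measure (EuclideanSpace ℝ (Fin d))}
  {ΩX ΩY : Type*} [MeasurableSpace ΩX] [MeasurableSpace ΩY]
  {PX : Measure ΩX} {PY : Measure ΩY}
  {X : ℕ → ΩX → EuclideanSpace ℝ (Fin d)} {Y : EuclideanSpace ℝ (Fin d) → ΩY → ℝ}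

lemma looMSE_eq (hd : 0 < d) (hv : IsGridEnumeration v) (hε : 0 ≤ ε)
    (hμ : IsPerturbationLaw μ) (hX_meas : ∀ i, Measurable (X i))
    (hX_law : ∀ i, PX.map (X i) = μ) {k k₀ : EuclideanSpace ℝ (Fin d) → ℝ}
    (hY : IsCenteredGaussianField k₀ Y PY) {l u : ℝ} (hl : 0 < l) (hu : 0 < u) (n : ℕ)
    (hk : ∀ s : Fin n → EuclideanSpace ℝ (Fin d), IsLatticeSeparated (1 - 2 * ε) s →
      SpectralBounds l u (covMatrix k s))
    (hk₀ : ∀ s : Fin n → EuclideanSpace ℝ (Fin d), IsLatticeSeparated (1 - 2 * ε) s →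
      SpectralBounds l u (covMatrix k₀ s)) :
    looMSE k v ε X PX Y PY n = ∫⁻ ω, ENNReal.ofReal ((1 / (n : ℝ)) *
      looForm (covMatrix k (fun i : Fin n => obsPoint v ε (fun j => X j ω) i))
        (covMatrix k₀ (fun i : Fin n => obsPoint v ε (fun j => X j ω) i))) ∂PX := by
  refine lintegral_congr_ae ?_
  filter_upwards [ae_forall_mem_cube hμ hX_meas hX_law] with ω hω
  have hs := isLatticeSeparated_obsPoint (hv.injective hd) hε hω n
  exact lintegral_loo_eq hY _ hl hu (hk _ hs) (hk₀ _ hs)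

/-- The excess leave-one-out error is comparable with the mean squared difference of the covariance
matrices. -/
theorem exists_looExcess_comparison [IsProbabilityMeasure PX] (hd : 0 < d) (hK : RegularModel θinf θsup K)
    (hcorr : ∀ θ ∈ paramSet p θinf θsup, K θ 0 = 1) (hθ₀ : θ₀ ∈ paramSet p θinf θsup)
    (hv : IsGridEnumeration v) (hε : 0 ≤ ε) (hε_lt : ε < 1 / 2) (hμ : IsPerturbationLaw μ)
    (hX_meas : ∀ i, Measurable (X i)) (hX_indep : iIndepFun X PX)
    (hX_law : ∀ i, PX.map (X i) = μ) (hY : IsCenteredGaussianField (K θ₀) Y PY) :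
    ∃ κ₁ κ₂ : ℝ, 0 < κ₁ ∧ 0 < κ₂ ∧ ∀ θ ∈ paramSet p θinf θsup, ∀ n : ℕ, ∀ a : ℝ≥0∞,
      a = ENNReal.ofReal (1 / (n : ℝ)) * ∑ i ∈ Finset.range n, ∑ j ∈ Finset.range n,
        pairEnergy μ ε (fun t => (K θ t - K θ₀ t) ^ 2) (v i - v j) →
      ((ENNReal.ofReal κ₁ * a : ℝ≥0∞) : EReal) ≤ looExcess (K θ) (K θ₀) v ε X PX Y PY n ∧
      looExcess (K θ) (K θ₀) v ε X PX Y PY n ≤ ((ENNReal.ofReal κ₂ * a : ℝ≥0∞) : EReal) := by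
  obtain ⟨l, u, hl, hu, hlu⟩ := hK.exists_spectralBounds (c := 1 - 2 * ε) (by linarith)
  have hb := one_le_opBound l u
  refine ⟨l / (4 * opBound l u ^ 8), u * (4 * opBound l u ^ 5), by positivity, by positivity,
    fun θ hθ n a ha => ?_⟩
  set κ₁ := l / (4 * opBound l u ^ 8)
  set κ₂ := u * (4 * opBound l u ^ 5)
  have hκ₁ : 0 ≤ κ₁ := by positivity
  have hκ₂ : 0 ≤ κ₂ := by positivity
  set s : ΩX → Fin n → EuclideanSpace ℝ (Fin d) :=
    fun ω i => obsPoint v ε (fun j => X j ω) i with hs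
  have hsep : ∀ᵐ ω ∂PX, IsLatticeSeparated (1 - 2 * ε) (s ω) := by
    filter_upwards [ae_forall_mem_cube hμ hX_meas hX_law] with ω hω
    exact isLatticeSeparated_obsPoint (hv.injective hd) hε hω n
  have e₀ : looMSE (K θ₀) v ε X PX Y PY n = ∫⁻ ω, ENNReal.ofReal ((1 / (n : ℝ)) *
      looForm (covMatrix (K θ₀) (s ω)) (covMatrix (K θ₀) (s ω))) ∂PX :=
    looMSE_eq hd hv hε hμ hX_meas hX_law hY hl hu n (hlu θ₀ hθ₀ n) (hlu θ₀ hθ₀ n)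
  have e : looMSE (K θ) v ε X PX Y PY n = ∫⁻ ω, ENNReal.ofReal ((1 / (n : ℝ)) *
      looForm (covMatrix (K θ) (s ω)) (covMatrix (K θ₀) (s ω))) ∂PX :=
    looMSE_eq hd hv hε hμ hX_meas hX_law hY hl hu n (hlu θ hθ n) (hlu θ₀ hθ₀ n)
  set m := looMSE (K θ) v ε X PX Y PY n
  set m₀ := looMSE (K θ₀) v ε X PX Y PY n
  set F : ΩX → ℝ := fun ω => frobSq (covMatrix (K θ) (s ω) - covMatrix (K θ₀) (s ω)) with hF
  have hFm : Measurable fun ω => ENNReal.ofReal (F ω) := by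
    have h1 := (hK.continuous hθ).measurable
    have h2 := (hK.continuous hθ₀).measurable
    simp only [hF, frobSq, Matrix.sub_apply, covMatrix, Matrix.of_apply, hs, obsPoint_sub]
    have h3 := fun i => hX_meas i
    fun_prop
  have hFint : ∫⁻ ω, ENNReal.ofReal (1 / (n : ℝ)) * ENNReal.ofReal (F ω) ∂PX = a := by
    rw [lintegral_const_mul _ hFm, ha]
    congr 1
    exact lintegral_frobSq (hv.injective hd) ε hX_meas hX_indep hX_law (hK.continuous hθ)
      (hK.continuous hθ₀) ((hcorr θ hθ).trans (hcorr θ₀ hθ₀).symm) n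
  have hn0 : 0 ≤ 1 / (n : ℝ) := by positivity
  have hdiag : ∀ θ ∈ paramSet p θinf θsup, ∀ ω i, covMatrix (K θ) (s ω) i i = 1 := by
    intro θ hθ ω i
    simp [covMatrix, hcorr θ hθ]
  -- Both bounds are stated additively in `ℝ≥0∞`; the finiteness of `m₀`, shown below, turns them
  -- into bounds on the difference in `EReal`.
  have hupper : m ≤ m₀ + ENNReal.ofReal κ₂ * a := by
    rw [e, e₀, ← hFint, ← lintegral_const_mul _ (hFm.const_mul _),
      ← lintegral_add_right _ ((hFm.const_mul _).const_mul _)]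
    refine lintegral_mono_ae ?_
    filter_upwards [hsep] with ω hω
    have h1 := (hlu θ hθ n _ hω).looForm_sub_le (hlu θ₀ hθ₀ n _ hω) hl hu
    have h2 := (hlu θ₀ hθ₀ n _ hω).looForm_nonneg (R := covMatrix (K θ₀) (s ω)) hl
    have h3 : 0 ≤ F ω := frobSq_nonneg _
    rw [← ENNReal.ofReal_mul hn0, ← ENNReal.ofReal_mul hκ₂,
      ← ENNReal.ofReal_add (by positivity) (by positivity)]
    refine ENNReal.ofReal_le_ofReal ?_
    have h4 := mul_le_mul_of_nonneg_left h1 hn0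
    change _ ≤ 1 / (n : ℝ) * (κ₂ * F ω) at h4
    linarith
  have hlower : ENNReal.ofReal κ₁ * a + m₀ ≤ m := by
    rw [e, e₀, ← hFint, ← lintegral_const_mul _ (hFm.const_mul _),
      ← lintegral_add_left ((hFm.const_mul _).const_mul _)]
    refine lintegral_mono_ae ?_
    filter_upwards [hsep] with ω hω
    have h1 := (hlu θ hθ n _ hω).le_looForm_sub (hlu θ₀ hθ₀ n _ hω) hl hu (hdiag θ hθ ω)
      (hdiag θ₀ hθ₀ ω)
    have h2 := (hlu θ₀ hθ₀ n _ hω).looForm_nonneg (R := covMatrix (K θ₀) (s ω)) hl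
    have h3 : 0 ≤ F ω := frobSq_nonneg _
    rw [← ENNReal.ofReal_mul hn0, ← ENNReal.ofReal_mul hκ₁,
      ← ENNReal.ofReal_add (by positivity) (by positivity)]
    refine ENNReal.ofReal_le_ofReal ?_
    have h4 := mul_le_mul_of_nonneg_left h1 hn0
    change 1 / (n : ℝ) * (κ₁ * F ω) ≤ _ at h4
    linarith
  have hfin : m₀ ≠ ∞ := by
    rw [e₀]
    refine ne_top_of_le_ne_top (b := ENNReal.ofReal ((1 / (n : ℝ)) *
      (u * (opBound l u ^ 2 * Fintype.card (Fin n))))) ENNReal.ofReal_ne_top ?_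
    refine (lintegral_mono_ae (g := fun _ => ENNReal.ofReal ((1 / (n : ℝ)) *
      (u * (opBound l u ^ 2 * Fintype.card (Fin n))))) ?_).trans (by simp)
    filter_upwards [hsep] with ω hω
    exact ENNReal.ofReal_le_ofReal
      (mul_le_mul_of_nonneg_left ((hlu θ₀ hθ₀ n _ hω).looForm_self_le hl hu) hn0)
  have hne_bot : (m₀ : EReal) ≠ ⊥ := EReal.coe_ennreal_ne_bot _
  have hne_top : (m₀ : EReal) ≠ ⊤ := by simpa using hfin
  constructor
  · change _ ≤ (m : EReal) - (m₀ : EReal)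
    rw [EReal.le_sub_iff_add_le (Or.inl hne_bot) (Or.inl hne_top), ← EReal.coe_ennreal_add]
    exact_mod_cast hlower
  · change (m : EReal) - (m₀ : EReal) ≤ _
    rw [EReal.sub_le_iff_le_add (Or.inl hne_bot) (Or.inl hne_top), ← EReal.coe_ennreal_add,
      add_comm]
    exact_mod_cast hupper

/-- The lower and upper limits of the excess leave-one-out error are comparable with the sum of the
pair energies. -/
theorem exists_liminf_limsup_bounds [IsProbabilityMeasure PX] (hd : 0 < d) (hK : RegularModel θinf θsup K)
    (hcorr : ∀ θ ∈ paramSet p θinf θsup, K θ 0 = 1) (hθ₀ : θ₀ ∈ paramSet p θinf θsup)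
    (hv : IsGridEnumeration v) (hε : 0 ≤ ε) (hε_lt : ε < 1 / 2) (hμ : IsPerturbationLaw μ)
    (hX_meas : ∀ i, Measurable (X i)) (hX_indep : iIndepFun X PX)
    (hX_law : ∀ i, PX.map (X i) = μ) (hY : IsCenteredGaussianField (K θ₀) Y PY) :
    ∃ κ₁ κ₂ : ℝ, 0 < κ₁ ∧ 0 < κ₂ ∧ ∀ θ ∈ paramSet p θinf θsup, ∀ J : ℝ≥0∞,
      J = ∑' w, pairEnergy μ ε (fun t => (K θ t - K θ₀ t) ^ 2) w →
      ((ENNReal.ofReal κ₁ * J : ℝ≥0∞) : EReal) ≤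
        liminf (fun n : ℕ => looExcess (K θ) (K θ₀) v ε X PX Y PY n) atTop ∧
      limsup (fun n : ℕ => looExcess (K θ) (K θ₀) v ε X PX Y PY n) atTop ≤
        ((ENNReal.ofReal κ₂ * J : ℝ≥0∞) : EReal) := by
  obtain ⟨κ₁, κ₂, h₁, h₂, h⟩ := exists_looExcess_comparison hd hK hcorr hθ₀ hv hε hε_lt hμ hX_meas
    hX_indep hX_law hY
  refine ⟨κ₁ / 2 ^ d, κ₂, by positivity, h₂, fun θ hθ J hJ => ?_⟩
  set G := pairEnergy μ ε (fun t => (K θ t - K θ₀ t) ^ 2)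
  have hninv : ∀ n : ℕ, 1 ≤ n → ENNReal.ofReal (1 / (n : ℝ)) * n = 1 := by
    intro n hn
    have : (0 : ℝ) < n := by exact_mod_cast hn
    rw [← ENNReal.ofReal_natCast n, ← ENNReal.ofReal_mul (by positivity),
      one_div_mul_cancel this.ne', ENNReal.ofReal_one]
  constructor
  -- The threshold on `n` depends on the finite set `F`, so the lower limit is bounded for each `F`
  -- before passing to the supremum.
  · have hF : ∀ F : Finset (Fin d → ℤ),
        ((ENNReal.ofReal (κ₁ / 2 ^ d) * ∑ w ∈ F, G w : ℝ≥0∞) : EReal) ≤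
        liminf (fun n : ℕ => looExcess (K θ) (K θ₀) v ε X PX Y PY n) atTop := by
      intro F
      obtain ⟨n₀, hn₀⟩ := hv.le_sum_sum hd G F
      refine le_liminf_of_le (by isBoundedDefault) ?_
      filter_upwards [eventually_ge_atTop (max n₀ 1)] with n hn
      have hn1 : 1 ≤ n := (le_max_right _ _).trans hn
      refine le_trans ?_ (h θ hθ n _ rfl).1
      rw [EReal.coe_ennreal_le_coe_ennreal_iff, ENNReal.ofReal_div_of_pos (by positivity),
        div_eq_mul_inv, mul_assoc]
      refine mul_le_mul' le_rfl ?_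
      have h3 := hn₀ n ((le_max_left _ _).trans hn)
      have h4 : ∑ w ∈ F, G w ≤ ENNReal.ofReal (1 / (n : ℝ)) *
          (2 ^ d * ∑ i ∈ Finset.range n, ∑ j ∈ Finset.range n, G (v i - v j)) := by
        calc ∑ w ∈ F, G w = ENNReal.ofReal (1 / (n : ℝ)) * (n * ∑ w ∈ F, G w) := by
              rw [← mul_assoc, hninv n hn1, one_mul]
          _ ≤ _ := by gcongr
      have h2d : (ENNReal.ofReal (2 ^ d)) = 2 ^ d := by
        rw [ENNReal.ofReal_pow (by norm_num)]; simp
      rw [h2d]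
      calc (2 ^ d)⁻¹ * ∑ w ∈ F, G w ≤ (2 ^ d)⁻¹ * (ENNReal.ofReal (1 / (n : ℝ)) *
          (2 ^ d * ∑ i ∈ Finset.range n, ∑ j ∈ Finset.range n, G (v i - v j))) := by gcongr
        _ = ((2 ^ d)⁻¹ * 2 ^ d) * (ENNReal.ofReal (1 / (n : ℝ)) *
          ∑ i ∈ Finset.range n, ∑ j ∈ Finset.range n, G (v i - v j)) := by ring
        _ = _ := by
          rw [ENNReal.inv_mul_cancel (by positivity) (by finiteness), one_mul]
    set L := liminf (fun n : ℕ => looExcess (K θ) (K θ₀) v ε X PX Y PY n) atTop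
    -- Nonnegativity lets the comparison with all partial sums take place in `ℝ≥0∞`.
    have hL : 0 ≤ L := by simpa using hF ∅
    rw [← EReal.coe_toENNReal hL] at hF ⊢
    simp only [EReal.coe_ennreal_le_coe_ennreal_iff] at hF ⊢
    rw [hJ, ← ENNReal.tsum_mul_left]
    refine ENNReal.summable.tsum_le_of_sum_le fun F => ?_
    rw [← Finset.mul_sum]
    exact hF F
  · refine limsup_le_of_le (by isBoundedDefault) ?_
    filter_upwards [eventually_ge_atTop 1] with n hn
    refine (h θ hθ n _ rfl).2.trans ?_
    rw [EReal.coe_ennreal_le_coe_ennreal_iff]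
    gcongr
    calc ENNReal.ofReal (1 / (n : ℝ)) * _ ≤ ENNReal.ofReal (1 / (n : ℝ)) * (n * ∑' w, G w) := by
          gcongr
          exact sum_sum_le_tsum (hv.injective hd) G n
      _ = J := by rw [← mul_assoc, hninv n hn, one_mul, hJ]

end Excess

/-! ### Continuity in the parameter -/

section Parameter

variable {d p : ℕ} {θinf θsup : ℝ} {K : (Fin p → ℝ) → EuclideanSpace ℝ (Fin d) → ℝ}

lemma update_mem_paramSet {θ : Fin p → ℝ} (hθ : θ ∈ paramSet p θinf θsup) {i : Fin p} {u : ℝ}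
    (hu : u ∈ Set.Icc θinf θsup) : Function.update θ i u ∈ paramSet p θinf θsup := by
  constructor
  · intro j
    rcases eq_or_ne j i with rfl | h
    · simpa using hu.1
    · simpa [Function.update_of_ne h] using hθ.1 j
  · intro j
    rcases eq_or_ne j i with rfl | h
    · simpa using hu.2
    · simpa [Function.update_of_ne h] using hθ.2 j

lemma RegularModel.exists_abs_update_sub_le (hK : RegularModel θinf θsup K) (i : Fin p) :
    ∃ C : ℝ, 0 ≤ C ∧ ∀ θ ∈ paramSet p θinf θsup, ∀ u ∈ Set.Icc θinf θsup, ∀ t,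
      |K (Function.update θ i u) t - K θ t| ≤ C * |u - θ i| := by
  obtain ⟨C, hC⟩ := hK.bound [i] (by simp)
  refine ⟨|C|, abs_nonneg _, fun θ hθ u hu t => ?_⟩
  set F : ℝ → ℝ := fun u' => K (Function.update θ i u') t with hF
  have hupd : ∀ x : ℝ, (fun u' : ℝ => partialTheta θinf θsup K []
      (Function.update (Function.update θ i x) i u') t) = F := by
    intro x; ext u'; simp [partialTheta, hF]
  have hdiff : DifferentiableOn ℝ F (Set.Icc θinf θsup) := by
    intro x hx
    have := hK.differentiable [] (by simp) i _ (update_mem_paramSet (i := i) hθ hx) t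
    rwa [hupd, Function.update_self] at this
  have hbd : ∀ x ∈ Set.Icc θinf θsup, ‖derivWithin F (Set.Icc θinf θsup) x‖ ≤ |C| := by
    intro x hx
    have h1 := hC _ (update_mem_paramSet (i := i) hθ hx) t
    have h2 : partialTheta θinf θsup K [i] (Function.update θ i x) t =
        derivWithin F (Set.Icc θinf θsup) x := by
      change derivWithin (fun u' : ℝ => partialTheta θinf θsup K []
        (Function.update (Function.update θ i x) i u') t) (Set.Icc θinf θsup)
        (Function.update θ i x i) = _
      rw [hupd, Function.update_self]
    rw [h2] at h1
    refine h1.trans (div_le_of_le_mul₀ (by positivity) (abs_nonneg _) ?_)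
    have h3 := le_abs_self C
    have h4 : 0 ≤ |C| * ‖t‖ ^ (d + 1) := by positivity
    linarith
  have h := (convex_Icc θinf θsup).norm_image_sub_le_of_norm_derivWithin_le hdiff hbd
    (x := θ i) (y := u) ⟨hθ.1 i, hθ.2 i⟩ hu
  simpa [hF] using h

lemma piecewise_mem_paramSet {θ θ' : Fin p → ℝ} (hθ : θ ∈ paramSet p θinf θsup)
    (hθ' : θ' ∈ paramSet p θinf θsup) (s : Finset (Fin p)) :
    s.piecewise θ' θ ∈ paramSet p θinf θsup := by
  constructor
  · intro j
    by_cases h : j ∈ s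
    · simpa [h] using hθ'.1 j
    · simpa [h] using hθ.1 j
  · intro j
    by_cases h : j ∈ s
    · simpa [h] using hθ'.2 j
    · simpa [h] using hθ.2 j

lemma RegularModel.continuousOn_param (hK : RegularModel θinf θsup K)
    (t : EuclideanSpace ℝ (Fin d)) : ContinuousOn (fun θ => K θ t) (paramSet p θinf θsup) := by
  choose C hC0 hC using hK.exists_abs_update_sub_le
  have hlip : ∀ θ ∈ paramSet p θinf θsup, ∀ θ' ∈ paramSet p θinf θsup,
      |K θ' t - K θ t| ≤ ∑ i, C i * |θ' i - θ i| := by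
    intro θ hθ θ' hθ'
    -- The coordinates are changed one at a time; the intermediate parameters stay in the cube.
    have key : ∀ s : Finset (Fin p), |K (s.piecewise θ' θ) t - K θ t| ≤
        ∑ i ∈ s, C i * |θ' i - θ i| := by
      intro s
      induction s using Finset.induction_on with
      | empty => simp
      | insert i s hi ih =>
        rw [Finset.sum_insert hi, Finset.piecewise_insert]
        have h1 := hC i _ (piecewise_mem_paramSet hθ hθ' s) (θ' i) ⟨hθ'.1 i, hθ'.2 i⟩ t
        rw [Finset.piecewise_eq_of_notMem _ _ _ hi] at h1
        have h2 := abs_sub_le (K (Function.update (s.piecewise θ' θ) i (θ' i)) t)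
          (K (s.piecewise θ' θ) t) (K θ t)
        linarith
    simpa using key Finset.univ
  intro θ hθ
  have hlim : Tendsto (fun θ' : Fin p → ℝ => ∑ i, C i * |θ' i - θ i|)
      (𝓝[paramSet p θinf θsup] θ) (𝓝 0) := by
    have hc : Continuous fun θ' : Fin p → ℝ => ∑ i, C i * |θ' i - θ i| := by fun_prop
    have := (hc.tendsto θ).mono_left (nhdsWithin_le_nhds (s := paramSet p θinf θsup))
    simpa using this
  rw [ContinuousWithinAt, tendsto_iff_dist_tendsto_zero]
  refine squeeze_zero' (Eventually.of_forall fun _ => dist_nonneg) ?_ hlim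
  filter_upwards [self_mem_nhdsWithin] with θ' hθ'
  exact hlip θ hθ θ' hθ'

/-- The decay profile `1 / (1 + ‖t‖^{d+1})`. -/
noncomputable def decay (d : ℕ) (t : EuclideanSpace ℝ (Fin d)) : ℝ := 1 / (1 + ‖t‖ ^ (d + 1))

lemma decay_nonneg (t : EuclideanSpace ℝ (Fin d)) : 0 ≤ decay d t := by
  unfold decay; positivity

lemma continuous_decay : Continuous (decay d) := by
  unfold decay
  refine continuous_const.div (by fun_prop) fun t => ?_
  positivity

lemma integrable_decay : Integrable (decay d) := by
  have h := integrable_one_add_norm (E := EuclideanSpace ℝ (Fin d)) (μ := volume)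
    (r := ((d + 1 : ℕ) : ℝ)) (by simp)
  refine (h.const_mul (2 ^ d)).mono' continuous_decay.aestronglyMeasurable
    (Eventually.of_forall fun t => ?_)
  rw [Real.norm_of_nonneg (decay_nonneg t), Real.rpow_neg (by positivity), Real.rpow_natCast,
    decay, ← div_eq_mul_inv, div_le_div_iff₀ (by positivity) (by positivity), one_mul]
  have := add_pow_le zero_le_one (norm_nonneg t) (d + 1)
  simpa using this

lemma RegularModel.exists_sq_sub_le (hK : RegularModel θinf θsup K) {θ₀ : Fin p → ℝ}
    (hθ₀ : θ₀ ∈ paramSet p θinf θsup) :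
    ∃ C : ℝ, 0 < C ∧ ∀ θ ∈ paramSet p θinf θsup, ∀ t, (K θ t - K θ₀ t) ^ 2 ≤ C * decay d t := by
  obtain ⟨C, hC, h⟩ := hK.exists_bound
  refine ⟨(2 * C) ^ 2, by positivity, fun θ hθ t => ?_⟩
  have h1 : ∀ θ ∈ paramSet p θinf θsup, |K θ t| ≤ C * decay d t := by
    intro θ hθ
    simpa [decay, div_eq_mul_inv] using h θ hθ t
  have h2 : |K θ t - K θ₀ t| ≤ 2 * C * decay d t := by
    have := abs_sub (K θ t) (K θ₀ t)
    linarith [h1 θ hθ, h1 θ₀ hθ₀]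
  have h3 : decay d t ≤ 1 := by
    unfold decay
    rw [div_le_one (by positivity)]
    have : 0 ≤ ‖t‖ ^ (d + 1) := by positivity
    linarith
  have h4 := decay_nonneg t
  calc (K θ t - K θ₀ t) ^ 2 = |K θ t - K θ₀ t| ^ 2 := (sq_abs _).symm
    _ ≤ (2 * C * decay d t) ^ 2 := pow_le_pow_left₀ (abs_nonneg _) h2 2
    _ = (2 * C) ^ 2 * (decay d t * decay d t) := by ring
    _ ≤ (2 * C) ^ 2 * (1 * decay d t) := by gcongr
    _ = _ := by ring

lemma RegularModel.integrable_sq_sub (hK : RegularModel θinf θsup K) {θ₀ θ : Fin p → ℝ}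
    (hθ₀ : θ₀ ∈ paramSet p θinf θsup) (hθ : θ ∈ paramSet p θinf θsup)
    {Q : Measure (EuclideanSpace ℝ (Fin d))} (hQ : Integrable (decay d) Q) :
    Integrable (fun t => (K θ t - K θ₀ t) ^ 2) Q := by
  obtain ⟨C, hC, h⟩ := hK.exists_sq_sub_le hθ₀
  have h1 := hK.continuous hθ
  have h2 := hK.continuous hθ₀
  refine (hQ.const_mul C).mono' (by fun_prop : Continuous fun t =>
    (K θ t - K θ₀ t) ^ 2).aestronglyMeasurable (Eventually.of_forall fun t => ?_)
  rw [Real.norm_of_nonneg (sq_nonneg _)]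
  exact h θ hθ t

/-- The measure `Q` is left general to cover both Lebesgue measure on `diffDomain` and
`pairMeasure`. -/
lemma RegularModel.continuousOn_integral_sq_sub (hK : RegularModel θinf θsup K) {θ₀ : Fin p → ℝ}
    (hθ₀ : θ₀ ∈ paramSet p θinf θsup) {Q : Measure (EuclideanSpace ℝ (Fin d))}
    (hQ : Integrable (decay d) Q) :
    ContinuousOn (fun θ => ∫ t, (K θ t - K θ₀ t) ^ 2 ∂Q) (paramSet p θinf θsup) := by
  obtain ⟨C, hC, h⟩ := hK.exists_sq_sub_le hθ₀
  refine continuousOn_of_dominated (bound := fun t => C * decay d t) ?_ ?_ (hQ.const_mul C) ?_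
  · exact fun θ hθ => (hK.integrable_sq_sub hθ₀ hθ hQ).aestronglyMeasurable
  · intro θ hθ
    refine Eventually.of_forall fun t => ?_
    rw [Real.norm_of_nonneg (sq_nonneg _)]
    exact h θ hθ t
  · exact Eventually.of_forall fun t =>
      ((hK.continuousOn_param t).sub continuousOn_const).pow 2

end Parameter

/-! ### The two integrals of the squared difference vanish together -/

section PairMeasure

variable {d : ℕ} {ε : ℝ} {μ : Measure (EuclideanSpace ℝ (Fin d))}

lemma decay_le_of_le_norm {t : EuclideanSpace ℝ (Fin d)} {r : ℝ} (hr : 0 < r) (h : r ≤ ‖t‖) :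
    decay d t ≤ r⁻¹ ^ (d + 1) := by
  rw [decay, inv_pow, ← one_div]
  refine one_div_le_one_div_of_le (by positivity) ?_
  have := pow_le_pow_left₀ hr.le h (d + 1)
  linarith

/-- The sum over `w ≠ 0` of the laws of `w + ε (x - y)`, for independent `x`, `y` with law `μ`. -/
noncomputable def pairMeasure (μ : Measure (EuclideanSpace ℝ (Fin d))) (ε : ℝ) :
    Measure (EuclideanSpace ℝ (Fin d)) :=
  Measure.sum fun w : {w : Fin d → ℤ // w ≠ 0} =>
    (μ.prod μ).map fun q => latticePoint w.1 + ε • (q.1 - q.2)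

lemma lintegral_pairMeasure {g : EuclideanSpace ℝ (Fin d) → ℝ} (hg : Continuous g) :
    ∫⁻ t, ENNReal.ofReal (g t) ∂(pairMeasure μ ε) = ∑' w, pairEnergy μ ε g w := by
  have hm := hg.measurable
  rw [pairMeasure, lintegral_sum_measure]
  have h1 : ∀ w : {w : Fin d → ℤ // w ≠ 0},
      ∫⁻ t, ENNReal.ofReal (g t) ∂((μ.prod μ).map fun q => latticePoint w.1 + ε • (q.1 - q.2)) =
        pairEnergy μ ε g w := by
    intro w
    rw [lintegral_map (by fun_prop) (by fun_prop), pairEnergy, if_neg w.2]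
  simp only [h1]
  exact tsum_subtype_eq_of_support_subset (f := pairEnergy μ ε g) (s := {w | w ≠ 0})
    fun w hw h0 => hw (by rw [h0, pairEnergy, if_pos rfl])

lemma integrable_decay_pairMeasure (hμ : IsPerturbationLaw μ) (hε : 0 ≤ ε) (hε_lt : ε < 1 / 2) :
    Integrable (decay d) (pairMeasure μ ε) := by
  have := hμ.probability
  refine ⟨continuous_decay.aestronglyMeasurable, ?_⟩
  rw [hasFiniteIntegral_iff_ofReal (Eventually.of_forall decay_nonneg),
    lintegral_pairMeasure continuous_decay]
  have hs : Summable fun w : Fin d → ℤ => (1 - 2 * ε)⁻¹ ^ (d + 1) * ‖w‖⁻¹ ^ (d + 1) :=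
    (summable_lattice_decay d).mul_left _
  refine lt_of_le_of_lt (ENNReal.tsum_le_tsum fun w => ?_) hs.tsum_ofReal_lt_top
  unfold pairEnergy
  by_cases hw : w = 0
  · rw [if_pos hw]; exact zero_le
  · rw [if_neg hw]
    refine (lintegral_mono_ae (g := fun _ =>
      ENNReal.ofReal ((1 - 2 * ε)⁻¹ ^ (d + 1) * ‖w‖⁻¹ ^ (d + 1))) ?_).trans (by simp)
    have h1 : ∀ᵐ q ∂(μ.prod μ), ∀ k, -1 ≤ q.1 k ∧ q.1 k ≤ 1 :=
      Measure.quasiMeasurePreserving_fst.ae (ae_mem_cube hμ)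
    have h2 : ∀ᵐ q ∂(μ.prod μ), ∀ k, -1 ≤ q.2 k ∧ q.2 k ≤ 1 :=
      Measure.quasiMeasurePreserving_snd.ae (ae_mem_cube hμ)
    filter_upwards [h1, h2] with q hq1 hq2
    refine ENNReal.ofReal_le_ofReal ?_
    have hwp : 0 < (1 - 2 * ε) * ‖w‖ := mul_pos (by linarith) (norm_pos_iff.2 hw)
    refine (decay_le_of_le_norm hwp (norm_latticePoint_add_ge hε hq1 hq2 hw)).trans (le_of_eq ?_)
    rw [mul_inv, mul_pow]

lemma tsum_pairEnergy_eq {g : EuclideanSpace ℝ (Fin d) → ℝ} (hg : Continuous g)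
    (hg0 : ∀ t, 0 ≤ g t) (hi : Integrable g (pairMeasure μ ε)) :
    ∑' w, pairEnergy μ ε g w = ENNReal.ofReal (∫ t, g t ∂(pairMeasure μ ε)) := by
  rw [ofReal_integral_eq_lintegral_ofReal hi (Eventually.of_forall hg0), lintegral_pairMeasure hg]

/-- If `g` were positive at `w + ε (t₁ - t₂)`, it would be positive for all pairs in a product of
neighbourhoods of `t₁` and `t₂`. These have positive mass, since both points lie in the support. -/
lemma eq_zero_on_diffDomain {g : EuclideanSpace ℝ (Fin d) → ℝ} [SFinite μ] (hg : Continuous g)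
    (hg0 : ∀ t, 0 ≤ g t) (h : ∑' w, pairEnergy μ ε g w = 0) :
    ∀ t ∈ diffDomain ε μ.support, g t = 0 := by
  rintro t ⟨w, hw, t₁, ht₁, t₂, ht₂, rfl⟩
  by_contra hne
  have hm := hg.measurable
  have h1 : pairEnergy μ ε g w = 0 := ENNReal.tsum_eq_zero.1 h w
  rw [pairEnergy, if_neg hw, lintegral_eq_zero_iff (by fun_prop)] at h1
  set U : Set (EuclideanSpace ℝ (Fin d) × EuclideanSpace ℝ (Fin d)) :=
    {q | 0 < g (latticePoint w + ε • (q.1 - q.2))} with hU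
  have hUo : IsOpen U := isOpen_lt continuous_const (by fun_prop)
  have hmem : (t₁, t₂) ∈ U := lt_of_le_of_ne (hg0 _) (Ne.symm hne)
  obtain ⟨V₁, V₂, hV₁, hV₂, h₁, h₂, hsub⟩ := isOpen_prod_iff.1 hUo t₁ t₂ hmem
  have hUz : (μ.prod μ) U = 0 := by
    refine measure_mono_null (fun q hq => ?_) (ae_iff.1 h1)
    have hq' : 0 < g (latticePoint w + ε • (q.1 - q.2)) := hq
    simpa using hq'
  have hz := measure_mono_null hsub hUz
  rw [Measure.prod_prod] at hz
  have hp₁ := (Measure.mem_support_iff_forall t₁).1 ht₁ V₁ (hV₁.mem_nhds h₁)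
  have hp₂ := (Measure.mem_support_iff_forall t₂).1 ht₂ V₂ (hV₂.mem_nhds h₂)
  rcases mul_eq_zero.1 hz with hz | hz
  · exact hp₁.ne' hz
  · exact hp₂.ne' hz

/-- The set where `g ≠ 0` in the domain is Lebesgue null. For fixed `y`, its preimage under `x ↦ w +
ε (x - y)` is null because `ε ≠ 0`, and therefore `μ`-null because `μ` has a density. -/
lemma tsum_pairEnergy_eq_zero {g : EuclideanSpace ℝ (Fin d) → ℝ} (hμ : IsPerturbationLaw μ)
    (hε : ε ≠ 0) (hg : Continuous g) (hg0 : ∀ t, 0 ≤ g t)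
    (hi : IntegrableOn g (diffDomain ε μ.support))
    (h : ∫ t in diffDomain ε μ.support, g t = 0) :
    ∑' w, pairEnergy μ ε g w = 0 := by
  have := hμ.probability
  have hm := hg.measurable
  have hμac : μ ≪ volume := by
    obtain ⟨f, _, hf, _⟩ := hμ.density
    rw [hf]
    exact withDensity_absolutelyContinuous _ _
  set D := diffDomain ε μ.support
  have hz := (integral_eq_zero_iff_of_nonneg hg0 hi).1 h
  have hopen : MeasurableSet {t | g t ≠ 0} := (hm (measurableSet_singleton 0)).compl
  -- Only `{g ≠ 0}` has to be measurable here, not `D`.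
  have hN : volume ({t | g t ≠ 0} ∩ D) = 0 := by
    rw [← Measure.restrict_apply hopen]
    exact ae_iff.1 hz
  refine ENNReal.tsum_eq_zero.2 fun w => ?_
  unfold pairEnergy
  by_cases hw : w = 0
  · rw [if_pos hw]
  rw [if_neg hw, lintegral_prod_symm _ (by fun_prop)]
  have hsupp := Measure.support_mem_ae (μ := μ)
  refine (lintegral_congr_ae (g := fun _ => 0) ?_).trans lintegral_zero
  filter_upwards [hsupp] with y hy
  refine (lintegral_congr_ae (g := fun _ => 0) ?_).trans lintegral_zero
  have hpre : volume {x : EuclideanSpace ℝ (Fin d) |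
      latticePoint w + ε • (x - y) ∈ {t | g t ≠ 0} ∩ D} = 0 := by
    have e : {x : EuclideanSpace ℝ (Fin d) | latticePoint w + ε • (x - y) ∈ {t | g t ≠ 0} ∩ D} =
        (fun x => ε • x) ⁻¹' ((fun x => (latticePoint w - ε • y) + x) ⁻¹'
          ({t | g t ≠ 0} ∩ D)) := by
      ext x
      have : latticePoint w + ε • (x - y) = latticePoint w - ε • y + ε • x := by
        rw [smul_sub]; abel
      simp only [Set.mem_preimage, Set.mem_ofPred_eq, this]
    rw [e, Measure.addHaar_preimage_smul _ hε, measure_preimage_add, hN, mul_zero]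
  have hae : ∀ᵐ x ∂μ, ¬ (latticePoint w + ε • (x - y) ∈ {t | g t ≠ 0} ∩ D) := by
    rw [ae_iff]
    simpa using hμac hpre
  filter_upwards [hae, hsupp] with x hx hxs
  have hD : latticePoint w + ε • (x - y) ∈ D := ⟨w, hw, x, hxs, y, hy, rfl⟩
  have hgz : g (latticePoint w + ε • (x - y)) = 0 := by
    by_contra hne
    exact hx ⟨hne, hD⟩
  simp [hgz]

end PairMeasure

lemma coe_ofReal_mul_ofReal {a b : ℝ} (ha : 0 ≤ a) (hb : 0 ≤ b) :
    ((ENNReal.ofReal a * ENNReal.ofReal b : ℝ≥0∞) : EReal) = ((a * b : ℝ) : EReal) := by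
  rw [← ENNReal.ofReal_mul ha, EReal.coe_ennreal_ofReal, max_eq_left (mul_nonneg ha hb)]

end KrigingLOO

theorem mainTheorem9 {d p : ℕ} (hd : 0 < d) (θinf θsup : ℝ)
    (K : (Fin p → ℝ) → EuclideanSpace ℝ (Fin d) → ℝ)
    (hK : KrigingLOO.RegularModel θinf θsup K)
    (hcorr : ∀ θ ∈ KrigingLOO.paramSet p θinf θsup, K θ 0 = 1)
    (θ₀ : Fin p → ℝ) (hθ₀ : ∀ i, θinf < θ₀ i ∧ θ₀ i < θsup)
    (v : ℕ → Fin d → ℤ) (hv : KrigingLOO.IsGridEnumeration v)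
    (ε : ℝ) (hε_nonneg : 0 ≤ ε) (hε_lt : ε < 1 / 2)
    (μ : Measure (EuclideanSpace ℝ (Fin d))) (hμ : KrigingLOO.IsPerturbationLaw μ)
    {ΩX ΩY : Type*} [MeasurableSpace ΩX] [MeasurableSpace ΩY]
    (PX : Measure ΩX) [IsProbabilityMeasure PX] (PY : Measure ΩY) [IsProbabilityMeasure PY]
    (X : ℕ → ΩX → EuclideanSpace ℝ (Fin d)) (hX_meas : ∀ i, Measurable (X i))
    (hX_indep : iIndepFun X PX) (hX_law : ∀ i, PX.map (X i) = μ)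
    (Y : EuclideanSpace ℝ (Fin d) → ΩY → ℝ)
    (hY : KrigingLOO.IsCenteredGaussianField (K θ₀) Y PY) :
    (ε = 0 → ∃ A B : ℝ, 0 < A ∧ A < B ∧ ∀ θ ∈ KrigingLOO.paramSet p θinf θsup,
      Summable (fun w : Fin d → ℤ =>
        (K θ (KrigingLOO.latticePoint w) - K θ₀ (KrigingLOO.latticePoint w)) ^ 2) ∧
      ((A * ∑' w : Fin d → ℤ,
          (K θ (KrigingLOO.latticePoint w) - K θ₀ (KrigingLOO.latticePoint w)) ^ 2 : ℝ) : EReal)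
        ≤ liminf (fun n : ℕ => KrigingLOO.looExcess (K θ) (K θ₀) v ε X PX Y PY n) atTop ∧
      limsup (fun n : ℕ => KrigingLOO.looExcess (K θ) (K θ₀) v ε X PX Y PY n) atTop
        ≤ ((B * ∑' w : Fin d → ℤ,
          (K θ (KrigingLOO.latticePoint w) - K θ₀ (KrigingLOO.latticePoint w)) ^ 2 : ℝ) : EReal))
    ∧
    (ε ≠ 0 →
      (∀ θ ∈ KrigingLOO.paramSet p θinf θsup,
        IntegrableOn (fun t => (K θ t - K θ₀ t) ^ 2) (KrigingLOO.diffDomain ε μ.support)) ∧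
      ∀ δ : ℝ, 0 < δ → ∃ A B : ℝ, 0 < A ∧ A < B ∧ ∀ θ ∈ KrigingLOO.paramSet p θinf θsup,
        ((∫ t in KrigingLOO.diffDomain ε μ.support, (K θ t - K θ₀ t) ^ 2) = 0 ∨
          δ ≤ ∫ t in KrigingLOO.diffDomain ε μ.support, (K θ t - K θ₀ t) ^ 2) →
        ((A * ∫ t in KrigingLOO.diffDomain ε μ.support, (K θ t - K θ₀ t) ^ 2 : ℝ) : EReal)
          ≤ liminf (fun n : ℕ => KrigingLOO.looExcess (K θ) (K θ₀) v ε X PX Y PY n) atTop ∧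
        limsup (fun n : ℕ => KrigingLOO.looExcess (K θ) (K θ₀) v ε X PX Y PY n) atTop
          ≤ ((B * ∫ t in KrigingLOO.diffDomain ε μ.support, (K θ t - K θ₀ t) ^ 2 : ℝ) : EReal)) := by
  have hθ₀' : θ₀ ∈ KrigingLOO.paramSet p θinf θsup :=
    ⟨fun i => (hθ₀ i).1.le, fun i => (hθ₀ i).2.le⟩
  obtain ⟨κ₁, κ₂, hκ₁, hκ₂, hκ⟩ := KrigingLOO.exists_liminf_limsup_bounds hd hK hcorr hθ₀' hv
    hε_nonneg hε_lt hμ hX_meas hX_indep hX_law hY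
  have hcont : ∀ θ ∈ KrigingLOO.paramSet p θinf θsup,
      Continuous fun t => (K θ t - K θ₀ t) ^ 2 := by
    intro θ hθ
    have h1 := hK.continuous hθ
    have h2 := hK.continuous hθ₀'
    fun_prop
  have := hμ.probability
  refine ⟨fun hε => ?_, fun hε => ⟨fun θ hθ => ?_, fun δ hδ => ?_⟩⟩
  · subst hε
    -- The sum `κ₁ + κ₂` ensures the strict inequality `A < B`.
    refine ⟨κ₁, κ₁ + κ₂, hκ₁, by linarith, fun θ hθ => ?_⟩
    obtain ⟨C, hC, hle⟩ := hK.exists_sq_sub_le hθ₀'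
    have hz : KrigingLOO.latticePoint (0 : Fin d → ℤ) = 0 := by
      ext k; simp [KrigingLOO.latticePoint]
    have hsum : Summable (fun w : Fin d → ℤ =>
        (K θ (KrigingLOO.latticePoint w) - K θ₀ (KrigingLOO.latticePoint w)) ^ 2) := by
      refine Summable.of_nonneg_of_le (fun _ => sq_nonneg _) (fun w => ?_)
        ((KrigingLOO.summable_lattice_decay d).mul_left C)
      -- At `w = 0` the majorant is `0` by convention, and the term vanishes because both
      -- correlations are 1.
      by_cases hw : w = 0
      · subst hw
        rw [hz, hcorr θ hθ, hcorr θ₀ hθ₀', sub_self]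
        simp
      · refine (hle θ hθ _).trans (mul_le_mul_of_nonneg_left ?_ hC.le)
        refine KrigingLOO.decay_le_of_le_norm (norm_pos_iff.2 hw) ?_
        simpa using KrigingLOO.norm_latticePoint_add_ge (ε := 0) le_rfl
          (x := (0 : EuclideanSpace ℝ (Fin d))) (y := 0) (by simp) (by simp) hw
    have hJ : ENNReal.ofReal (∑' w : Fin d → ℤ,
        (K θ (KrigingLOO.latticePoint w) - K θ₀ (KrigingLOO.latticePoint w)) ^ 2) =
        ∑' w, KrigingLOO.pairEnergy μ 0 (fun t => (K θ t - K θ₀ t) ^ 2) w := by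
      rw [ENNReal.ofReal_tsum_of_nonneg (fun _ => sq_nonneg _) hsum]
      refine tsum_congr fun w => ?_
      unfold KrigingLOO.pairEnergy
      by_cases hw : w = 0
      · subst hw
        rw [if_pos rfl, hz, hcorr θ hθ, hcorr θ₀ hθ₀', sub_self]
        simp
      · rw [if_neg hw]
        simp
    have hI0 : 0 ≤ ∑' w : Fin d → ℤ,
        (K θ (KrigingLOO.latticePoint w) - K θ₀ (KrigingLOO.latticePoint w)) ^ 2 :=
      tsum_nonneg fun _ => sq_nonneg _
    have h := hκ θ hθ _ hJ
    rw [KrigingLOO.coe_ofReal_mul_ofReal hκ₁.le hI0,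
      KrigingLOO.coe_ofReal_mul_ofReal hκ₂.le hI0] at h
    refine ⟨hsum, h.1, h.2.trans ?_⟩
    rw [EReal.coe_le_coe_iff]
    exact mul_le_mul_of_nonneg_right (by linarith) hI0
  · exact hK.integrable_sq_sub hθ₀' hθ KrigingLOO.integrable_decay.integrableOn
  · set D := KrigingLOO.diffDomain ε μ.support
    set Q := KrigingLOO.pairMeasure μ ε
    have hQ : Integrable (KrigingLOO.decay d) Q :=
      KrigingLOO.integrable_decay_pairMeasure hμ hε_nonneg hε_lt
    have hD : Integrable (KrigingLOO.decay d) (volume.restrict D) :=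
      KrigingLOO.integrable_decay.integrableOn
    set I : (Fin p → ℝ) → ℝ := fun θ => ∫ t in D, (K θ t - K θ₀ t) ^ 2 with hI
    set J : (Fin p → ℝ) → ℝ := fun θ => ∫ t, (K θ t - K θ₀ t) ^ 2 ∂Q with hJ
    have hIc : ContinuousOn I (KrigingLOO.paramSet p θinf θsup) :=
      hK.continuousOn_integral_sq_sub hθ₀' hD
    have hJc : ContinuousOn J (KrigingLOO.paramSet p θinf θsup) :=
      hK.continuousOn_integral_sq_sub hθ₀' hQ
    have hJt : ∀ θ ∈ KrigingLOO.paramSet p θinf θsup, ENNReal.ofReal (J θ) =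
        ∑' w, KrigingLOO.pairEnergy μ ε (fun t => (K θ t - K θ₀ t) ^ 2) w := fun θ hθ =>
      (KrigingLOO.tsum_pairEnergy_eq (hcont θ hθ) (fun _ => sq_nonneg _)
        (hK.integrable_sq_sub hθ₀' hθ hQ)).symm
    have hI0 : ∀ θ, 0 ≤ I θ := fun θ => integral_nonneg fun _ => sq_nonneg _
    have hJ0 : ∀ θ, 0 ≤ J θ := fun θ => integral_nonneg fun _ => sq_nonneg _
    have hcomp : IsCompact (KrigingLOO.paramSet p θinf θsup) := isCompact_Icc
    have hcompδ : IsCompact (KrigingLOO.paramSet p θinf θsup ∩ I ⁻¹' Set.Ici δ) :=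
      hcomp.of_isClosed_subset (hIc.preimage_isClosed_of_isClosed hcomp.isClosed isClosed_Ici)
        Set.inter_subset_left
    -- On the compact set `{I ≥ δ}` the continuous function `J` has no zero, since a zero of `J`
    -- would be one of `I`.
    obtain ⟨m, hm, hmJ⟩ := hcompδ.exists_forall_le' (hJc.mono Set.inter_subset_left) (a := 0)
      (by
        rintro θ ⟨hθ, hθδ⟩
        refine lt_of_le_of_ne (hJ0 θ) fun h0 => ?_
        have h1 := hJt θ hθ
        rw [← h0, ENNReal.ofReal_zero] at h1
        have h2 := KrigingLOO.eq_zero_on_diffDomain (hcont θ hθ) (fun _ => sq_nonneg _) h1.symm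
        have h3 : I θ = 0 := setIntegral_eq_zero_of_forall_eq_zero h2
        rw [Set.mem_preimage, h3, Set.mem_Ici] at hθδ
        linarith)
    obtain ⟨CI, hCI⟩ := hcomp.exists_bound_of_continuousOn hIc
    obtain ⟨CJ, hCJ⟩ := hcomp.exists_bound_of_continuousOn hJc
    have hIle : ∀ θ ∈ KrigingLOO.paramSet p θinf θsup, I θ ≤ |CI| + 1 := fun θ hθ => by
      linarith [(le_abs_self _).trans (hCI θ hθ), le_abs_self CI]
    have hJle : ∀ θ ∈ KrigingLOO.paramSet p θinf θsup, J θ ≤ |CJ| := fun θ hθ =>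
      (le_abs_self _).trans ((hCJ θ hθ).trans (le_abs_self CJ))
    have hA : 0 < κ₁ * m / (|CI| + 1) := by positivity
    have hB : 0 ≤ κ₂ * |CJ| / δ := by positivity
    -- On `{I ≥ δ}`, `J ≥ m ≥ m I / (|CI| + 1)` and `J ≤ |CJ| ≤ |CJ| I / δ`. The `+ 1` in the
    -- denominator keeps it positive; the extra terms in `B` give `A < B`.
    refine ⟨κ₁ * m / (|CI| + 1), κ₁ * m / (|CI| + 1) + κ₂ * |CJ| / δ + 1, hA, by linarith,
      fun θ hθ hcase => ?_⟩
    have h := hκ θ hθ _ (hJt θ hθ)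
    rw [KrigingLOO.coe_ofReal_mul_ofReal hκ₁.le (hJ0 θ),
      KrigingLOO.coe_ofReal_mul_ofReal hκ₂.le (hJ0 θ)] at h
    change I θ = 0 ∨ δ ≤ I θ at hcase
    change ((κ₁ * m / (|CI| + 1) * I θ : ℝ) : EReal) ≤ _ ∧
      _ ≤ (((κ₁ * m / (|CI| + 1) + κ₂ * |CJ| / δ + 1) * I θ : ℝ) : EReal)
    rcases hcase with hzero | hge
    · have hJz : J θ = 0 := by
        have h1 := KrigingLOO.tsum_pairEnergy_eq_zero hμ hε (hcont θ hθ) (fun _ => sq_nonneg _)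
          (hK.integrable_sq_sub hθ₀' hθ hD) hzero
        rw [← hJt θ hθ, ENNReal.ofReal_eq_zero] at h1
        exact le_antisymm h1 (hJ0 θ)
      rw [hJz, mul_zero, mul_zero] at h
      rw [hzero, mul_zero, mul_zero]
      exact h
    · refine ⟨le_trans ?_ h.1, h.2.trans ?_⟩
      · rw [EReal.coe_le_coe_iff, div_mul_eq_mul_div, div_le_iff₀ (by positivity), mul_assoc,
          mul_assoc]
        exact mul_le_mul_of_nonneg_left
          (mul_le_mul (hmJ θ ⟨hθ, hge⟩) (hIle θ hθ) (hI0 θ) (hJ0 θ)) hκ₁.le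
      · rw [EReal.coe_le_coe_iff]
        have h1 : κ₂ * J θ ≤ κ₂ * |CJ| / δ * I θ := by
          rw [div_mul_eq_mul_div, le_div_iff₀ hδ]
          exact mul_le_mul (mul_le_mul_of_nonneg_left (hJle θ hθ) hκ₂.le) hge hδ.le
            (by positivity)
        nlinarith [hI0 θ, mul_nonneg hA.le (hI0 θ)]
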